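/- Let $n\ge 0$ be an integer and $[n]=\{1,\dots,n\}$. For a finite poset $S$ and $k\ge 0$ let $c_k(S)$ be the maximal cardinality of a union of $k$ chains (totally ordered subsets, possibly empty) of $S$. The shape $\lambda(S)$ is the diagram whose $k$-th row has $\lambda_k(S)=c_k(S)-c_{k-1}(S)$ boxes, $k\ge 1$. The standard Young tableau associated with a linear extension $\varphi:S\to[|S|]$ (an order-preserving bijection) is the tableau $T$ defined by the condition that, for every $k\geq 0$, the boxes of $T$ with entries $1,\dots,k$ form the shape $\lambda(\varphi^{-1}(\{1,\dots,k\}))$. For a permutation $\sigma$ of $[n]$, let $P_\sigma$ be the set of points $(i,\sigma(i))$, $i\in[n]$, ordered by $(i,\sigma(i))\le(j,\sigma(j))$ if and only if $i\le j$ and $\sigma(i)\le\sigma(j)$. Let $P(\sigma)$ and $Q(\sigma)$ be the standard Young tableaux associated with the linear extensions $(i,\sigma(i))\mapsto\sigma(i)$ and $(i,\sigma(i))\mapsto i$ of $P_\sigma$, respectively. Then $P(\sigma)$ and $Q(\sigma)$ are well defined (for each $\sigma$, exactly one pair of standard Young tableaux of the same shape with $n$ boxes satisfies these conditions), and the map $\sigma\mapsto(P(\sigma),Q(\sigma))$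 is a bijection from the set of permutations of $[n]$ onto the set of pairs of standard Young tableaux of the same shape consisting of $n$ boxes. -/

import Mathlib

/-! ## Greene's shape of a finite poset -/

section GreeneShape

variable {α : Type*} [PartialOrder α]

open scoped Classical in
/-- `maxChainUnion S k` is the number `c_k` of the finite poset `S` (with the order induced from
`α`): the maximal cardinality of a subset of `S` that is a union of `k` chains
(chains may be empty and may overlap). -/
noncomputable def maxChainUnion (S : Finset α) (k : ℕ) : ℕ :=
  (S.powerset.filter fun U =>
    ∃ C : Fin k → Finset α,
      (∀ i, IsChain (· ≤ ·) (C i : Set α)) ∧ U = Finset.univ.biUnion C).sup Finset.card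

/-- `greeneRow S i` is the length of row `i` of the shape `λ(S)`, with rows counted from `0`:
the number `λ_{i+1} = c_{i+1} - c_i`. The sequence `c` is weakly increasing, so the subtraction
is not truncated. -/
noncomputable def greeneRow (S : Finset α) (i : ℕ) : ℕ :=
  maxChainUnion S (i + 1) - maxChainUnion S i

/-- The set of boxes `(row, column)`, both counted from `0`, of the shape `λ(S)`. -/
def greeneShape (S : Finset α) : Set (ℕ × ℕ) :=
  {c | c.2 < greeneRow S c.1}

end GreeneShape

/-! ## Standard Young tableaux -/

/-- A standard Young tableau of shape `μ`: a filling of the boxes of `μ` by the numbers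
`1, …, |μ|`, each used once, whose entries increase along rows and down columns.
(Semistandard fillings are weakly increasing along rows; with distinct entries, strictly.
As for semistandard tableaux, `entry` is `0` outside `μ`.) -/
structure StandardYoungTableau (μ : YoungDiagram) extends SemistandardYoungTableau μ where
  bijOn' : Set.BijOn (fun c : ℕ × ℕ => entry c.1 c.2) {c | c ∈ μ} (Set.Icc 1 μ.card)

/-- A pair `(P, Q)` of standard Young tableaux of the same shape consisting of `n` boxes. -/
structure StandardYoungTableauPair (n : ℕ) where
  shape : YoungDiagram
  card_shape : shape.card = n
  P : StandardYoungTableau shape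
  Q : StandardYoungTableau shape

/-! ## The tableau of a linear extension -/

/-- A linear extension of a poset with `n` elements: an order-preserving bijection onto `[n]`.
The set `[n] = {1, …, n}` is represented by `Fin n = {0, …, n - 1}`, that is, `i` by `i - 1`. -/
structure PosetLinearExtension (α : Type*) [PartialOrder α] (n : ℕ) where
  toFun : α → Fin n
  bijective : Function.Bijective toFun
  monotone : Monotone toFun

/-- The order ideal `φ⁻¹({1, …, k})` of the first `k` elements in the order given by `φ`. -/
def PosetLinearExtension.firstElements {α : Type*} [PartialOrder α] [Fintype α] {n : ℕ}
    (φ : PosetLinearExtension α n) (k : ℕ) : Finset α :=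
  Finset.univ.filter fun p => (φ.toFun p : ℕ) < k

/-- `T` is the standard tableau associated with the linear extension `φ`: for every `k`, the boxes
with entries `1, …, k` form the shape of the order ideal `φ⁻¹({1, …, k})`. -/
def IsTableauOfLinearExtension {α : Type*} [PartialOrder α] [Fintype α] {n : ℕ}
    (φ : PosetLinearExtension α n) {μ : YoungDiagram} (T : StandardYoungTableau μ) : Prop :=
  ∀ k : ℕ, {c : ℕ × ℕ | c ∈ μ ∧ T.entry c.1 c.2 ≤ k} = greeneShape (φ.firstElements k)

/-! ## Permutation posets and their two tableaux -/

/-- The permutation poset of `σ`: the points `(i, σ i)` with the order induced from the product of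
chains `[n] × [n]`. -/
abbrev PermutationPoset {n : ℕ} (σ : Equiv.Perm (Fin n)) : Type :=
  {p : Fin n × Fin n // p.2 = σ p.1}

/-- The points `(i, σ i)` ordered by the second coordinate. -/
def linearExtensionByValue {n : ℕ} (σ : Equiv.Perm (Fin n)) :
    PosetLinearExtension (PermutationPoset σ) n where
  toFun p := p.1.2
  bijective := by
    refine ⟨?_, fun j => ⟨⟨(σ.symm j, j), by simp⟩, rfl⟩⟩
    rintro ⟨⟨a, b⟩, h⟩ ⟨⟨a', b'⟩, h'⟩ (hb : b = b')
    subst hb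
    have : a = a' := σ.injective (h.symm.trans h')
    subst this
    rfl
  monotone := fun _ _ h => h.2

/-- The points `(i, σ i)` ordered by the first coordinate. -/
def linearExtensionByPosition {n : ℕ} (σ : Equiv.Perm (Fin n)) :
    PosetLinearExtension (PermutationPoset σ) n where
  toFun p := p.1.1
  bijective := by
    refine ⟨?_, fun i => ⟨⟨(i, σ i), rfl⟩, rfl⟩⟩
    rintro ⟨⟨a, b⟩, h⟩ ⟨⟨a', b'⟩, h'⟩ (ha : a = a')
    subst ha
    have : b = b' := h.trans h'.symm
    subst this
    rfl
  monotone := fun _ _ h => h.1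

/-- `(P, Q) = (P(σ), Q(σ))`: the tableaux `P` and `Q` are those associated with the linear
extensions of the permutation poset of `σ` by value and by position, respectively. -/
def IsRobinsonSchenstedPair {n : ℕ} (σ : Equiv.Perm (Fin n))
    (T : StandardYoungTableauPair n) : Prop :=
  IsTableauOfLinearExtension (linearExtensionByValue σ) T.P ∧
    IsTableauOfLinearExtension (linearExtensionByPosition σ) T.Q

/-! The points of the permutation poset, listed by position, form the word of `σ`, and `c_k` is the
largest number of letters of this word covered by `k` increasing subwords. Knuth transformations
preserve these numbers, and for the reading word of a tableau they are the partial sums of the row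
lengths: each row is a chain, and `k` chains meet each column at most `k` times. Now row insertion
replaces a word by the reading word of a tableau through Knuth transformations, which are compatible
with the deletion of large letters. So the shape of the points of value at most `k` is formed by the
letters `≤ k` of the insertion tableau, and the shape of the first `k` points is the shape of the
insertion tableau of a prefix: the conditions on `P(σ)` and `Q(σ)` say that they are the insertion
tableau and the recording tableau of `σ`. Reverse row insertion recovers `σ` from them and produces
a `σ` for every pair. That there is a standard tableau satisfying the condition on `Q(σ)` follows by
reflecting the poset in the diagonal, which turns the condition into that on `P(σ⁻¹)`. -/

/-! ### Chain covers and Knuth equivalence -/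

section ChainCover

variable {α : Type*} {r : α → α → Prop} {w : List α} {x y z : α} {k m : ℕ}

/-- A word whose letters carry colours, the colours `0, …, k - 1` being the names of `k` chains
for `r` (read from left to right); the letters of colour at least `k` lie on none of them. -/
def IsChainColouring (r : α → α → Prop) (k : ℕ) (L : List (α × ℕ)) : Prop :=
  L.Pairwise fun p q => p.2 = q.2 → p.2 < k → r p.1 q.1

/-- At least `m` letters of the word `w` can be covered by `k` subwords that are chains for `r`.
The subwords are disjoint, which loses no generality. -/
def HasChainCover (r : α → α → Prop) (w : List α) (k m : ℕ) : Prop :=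
  ∃ L : List (α × ℕ), L.map Prod.fst = w ∧ IsChainColouring r k L ∧ m ≤ L.countP (·.2 < k)

theorem IsChainColouring.swap_adjacent {p q : α × ℕ} {u v : List (α × ℕ)}
    (h : IsChainColouring r k (u ++ p :: q :: v)) (hqp : q.2 = p.2 → q.2 < k → r q.1 p.1) :
    IsChainColouring r k (u ++ q :: p :: v) := by
  simp only [IsChainColouring, List.pairwise_append, List.pairwise_cons, List.mem_cons,
    forall_eq_or_imp] at h ⊢
  grind

theorem IsChainColouring.exchange_uncoloured [IsTrans α r] {c e : ℕ} {u v : List (α × ℕ)}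
    (hxy : r x y) (hyz : r y z) (he : k ≤ e)
    (h : IsChainColouring r k (u ++ (x, c) :: (z, c) :: (y, e) :: v)) :
    IsChainColouring r k (u ++ (z, e) :: (x, c) :: (y, c) :: v) := by
  have trans := fun {a b c : α} => _root_.trans (r := r) (a := a) (b := b) (c := c)
  simp only [IsChainColouring, List.pairwise_append, List.pairwise_cons, List.mem_cons,
    forall_eq_or_imp] at h ⊢
  grind

theorem IsChainColouring.exchange_tails [IsTrans α r] {c e : ℕ} {u v : List (α × ℕ)}
    (hxy : r x y) (hyz : r y z) (hc : c < k) (he : e < k) (hce : c ≠ e)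
    (h : IsChainColouring r k (u ++ (x, c) :: (z, c) :: (y, e) :: v)) :
    IsChainColouring r k
      (u ++ (z, e) :: (x, c) :: (y, c) :: v.map (Prod.map id (Equiv.swap c e))) := by
  have trans := fun {a b c : α} => _root_.trans (r := r) (a := a) (b := b) (c := c)
  simp only [IsChainColouring, List.pairwise_append, List.pairwise_cons, List.mem_cons,
    forall_eq_or_imp, List.pairwise_map, List.forall_mem_map, Prod.map, id,
    Equiv.swap_apply_def] at h ⊢
  grind

theorem HasChainCover.reverse (h : HasChainCover r w k m) :
    HasChainCover (Function.swap r) w.reverse k m := by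
  obtain ⟨L, rfl, hL, hm⟩ := h
  refine ⟨L.reverse, by simp, ?_, by simpa using hm⟩
  exact List.pairwise_reverse.2 (hL.imp fun h e hk => h e.symm (e.symm.trans_lt hk))

theorem HasChainCover.swap_of_not_rel {u v : List α} (hzx : ¬ r z x)
    (h : HasChainCover r (u ++ z :: x :: v) k m) : HasChainCover r (u ++ x :: z :: v) k m := by
  obtain ⟨L, hL, hcol, hm⟩ := h
  obtain ⟨u, _, rfl, rfl, h₁⟩ := List.map_eq_append_iff.1 hL
  obtain ⟨⟨z, d⟩, _, rfl, rfl, h₂⟩ := List.map_eq_cons_iff.1 h₁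
  obtain ⟨⟨x, c⟩, v, rfl, rfl, rfl⟩ := List.map_eq_cons_iff.1 h₂
  have hzd : c = d → ¬ c < k := by
    rintro rfl hc
    exact hzx (List.rel_of_pairwise_cons (List.pairwise_append.1 hcol).2.1
      List.mem_cons_self rfl hc)
  exact ⟨u ++ (x, c) :: (z, d) :: v, by simp,
    hcol.swap_adjacent fun hcd hc => absurd hc (hzd hcd),
    hm.trans_eq (((List.Perm.swap _ _ v).append_left u).countP_eq _)⟩

theorem HasChainCover.swap_of_rel_of_rel [IsTrans α r] {u v : List α} (hxy : r x y) (hyz : r y z)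
    (hzy : ¬ r z y) (h : HasChainCover r (u ++ x :: z :: y :: v) k m) :
    HasChainCover r (u ++ z :: x :: y :: v) k m := by
  obtain ⟨L, hL, hcol, hm⟩ := h
  obtain ⟨u, _, rfl, rfl, h₁⟩ := List.map_eq_append_iff.1 hL
  obtain ⟨⟨x, c⟩, _, rfl, rfl, h₂⟩ := List.map_eq_cons_iff.1 h₁
  obtain ⟨⟨z, d⟩, _, rfl, rfl, h₃⟩ := List.map_eq_cons_iff.1 h₂
  obtain ⟨⟨y, e⟩, v, rfl, rfl, rfl⟩ := List.map_eq_cons_iff.1 h₃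
  by_cases hcd : c = d ∧ c < k
  · obtain ⟨rfl, hc⟩ := hcd
    -- The chain of `x` and `z` is rerouted through `y`; what followed `y` on its own chain goes
    -- along, while what followed `z` now continues the chain `e`.
    by_cases he : e < k
    · have hce : c ≠ e := by
        rintro rfl
        exact hzy (List.rel_of_pairwise_cons (List.pairwise_append.1 hcol).2.1.of_cons
          List.mem_cons_self rfl hc)
      have hswap (a : ℕ) : Equiv.swap c e a < k ↔ a < k := by grind
      refine ⟨_, by simp, hcol.exchange_tails hxy hyz hc he hce, hm.trans_eq ?_⟩
      simp [List.countP_map, Function.comp_def, hswap, hc, he]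
    · refine ⟨_, by simp, hcol.exchange_uncoloured hxy hyz (not_lt.1 he), hm.trans_eq ?_⟩
      simp [hc, he]
  · exact ⟨u ++ (z, d) :: (x, c) :: (y, e) :: v, by simp,
      hcol.swap_adjacent fun hdc hd => absurd ⟨hdc.symm, hdc.symm.trans_lt hd⟩ hcd,
      hm.trans_eq (((List.Perm.swap _ _ _).append_left u).countP_eq _)⟩

end ChainCover

section Knuth

variable {α : Type*}

/-- The elementary Knuth transformations of words with letters in an ordered set. -/
inductive KnuthStep [LT α] : List α → List α → Prop
  | left (u v : List α) {x y z : α} (hxy : x < y) (hyz : y < z) :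
      KnuthStep (u ++ x :: z :: y :: v) (u ++ z :: x :: y :: v)
  | right (u v : List α) {x y z : α} (hxy : x < y) (hyz : y < z) :
      KnuthStep (u ++ y :: x :: z :: v) (u ++ y :: z :: x :: v)

/-- Knuth equivalence of words. -/
abbrev KnuthEquiv [LT α] : List α → List α → Prop := Relation.EqvGen KnuthStep

theorem KnuthEquiv.map [LT α] {β : Type*} [LT β] {f : List α → List β}
    (hf : ∀ {w w'}, KnuthStep w w' → KnuthEquiv (f w) (f w')) {w w' : List α}
    (h : KnuthEquiv w w') : KnuthEquiv (f w) (f w') := by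
  induction h with
  | rel _ _ h => exact hf h
  | refl _ => exact .refl _
  | symm _ _ _ ih => exact ih.symm
  | trans _ _ _ _ _ ih₁ ih₂ => exact ih₁.trans _ _ _ ih₂

theorem KnuthStep.append [LT α] {w w' : List α} (h : KnuthStep w w') (u v : List α) :
    KnuthStep (u ++ w ++ v) (u ++ w' ++ v) := by
  cases h with
  | left a b hxy hyz => simpa using left (u ++ a) (b ++ v) hxy hyz
  | right a b hxy hyz => simpa using right (u ++ a) (b ++ v) hxy hyz

theorem KnuthEquiv.append [LT α] {w w' : List α} (h : KnuthEquiv w w') (u v : List α) :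
    KnuthEquiv (u ++ w ++ v) (u ++ w' ++ v) :=
  h.map (f := fun w => u ++ w ++ v) fun h => .rel _ _ (h.append u v)

theorem KnuthStep.perm [LT α] {w w' : List α} (h : KnuthStep w w') : w.Perm w' := by
  cases h with
  | left u v => exact .append_left u (.swap _ _ _)
  | right u v => exact .append_left u (.cons _ (.swap _ _ _))

theorem KnuthEquiv.perm [LT α] {w w' : List α} (h : KnuthEquiv w w') : w.Perm w' :=
  (List.Perm.eqv α).eqvGen_iff.1 (h.mono fun _ _ => KnuthStep.perm)

theorem KnuthStep.filter_le [LinearOrder α] {w w' : List α} (h : KnuthStep w w') (k : α) :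
    KnuthEquiv (w.filter (· ≤ k)) (w'.filter (· ≤ k)) := by
  cases h with
  | @left u v x y z hxy hyz =>
    by_cases hz : z ≤ k
    · have hy := hyz.le.trans hz
      simpa [hz, hy, hxy.le.trans hy] using .rel _ _ (left _ _ hxy hyz)
    · simpa [List.filter_cons, hz] using .refl _
  | @right u v x y z hxy hyz =>
    by_cases hz : z ≤ k
    · have hy := hyz.le.trans hz
      simpa [hz, hy, hxy.le.trans hy] using .rel _ _ (right _ _ hxy hyz)
    · simpa [List.filter_cons, hz] using .refl _

theorem KnuthEquiv.filter_le [LinearOrder α] {w w' : List α} (h : KnuthEquiv w w') (k : α) :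
    KnuthEquiv (w.filter (· ≤ k)) (w'.filter (· ≤ k)) :=
  h.map fun h => h.filter_le k

theorem KnuthStep.hasChainCover_iff [Preorder α] {w w' : List α} (h : KnuthStep w w') (k m : ℕ) :
    HasChainCover (· < ·) w k m ↔ HasChainCover (· < ·) w' k m := by
  cases h with
  | left u v hxy hyz =>
    exact ⟨.swap_of_rel_of_rel hxy hyz hyz.asymm, .swap_of_not_rel (hxy.trans hyz).asymm⟩
  | @right u v x y z hxy hyz =>
    refine ⟨fun h => ?_, fun h => ?_⟩
    · have h : HasChainCover (· > ·) (v.reverse ++ z :: x :: y :: u.reverse) k m := by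
        simpa using h.reverse
      simpa using (h.swap_of_rel_of_rel (r := (· > ·)) hyz hxy hxy.asymm).reverse
    · have h : HasChainCover (· < ·) ((u ++ [y]) ++ z :: x :: v) k m := by simpa using h
      simpa using h.swap_of_not_rel (hxy.trans hyz).asymm

theorem KnuthEquiv.hasChainCover_iff [Preorder α] {w w' : List α} (h : KnuthEquiv w w')
    (k m : ℕ) : HasChainCover (· < ·) w k m ↔ HasChainCover (· < ·) w' k m := by
  induction h with
  | rel _ _ h => exact h.hasChainCover_iff k m
  | refl _ => exact Iff.rfl
  | symm _ _ _ ih => exact ih.symm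
  | trans _ _ _ _ _ ih₁ ih₂ => exact ih₁.trans ih₂

end Knuth

/-! ### Tableaux as lists of rows -/

section RowBelow

variable {α β : Type*} {r : α → α → Prop} {a b : α} {R S : List α}

/-- The row `S` fits below the row `R`: it is not longer, and each of its entries is `r`-related to
the entry above it. -/
inductive RowBelow (r : α → α → Prop) : List α → List α → Prop
  | nil (R : List α) : RowBelow r R []
  | cons {a b : α} {R S : List α} (hab : r a b) (h : RowBelow r R S) : RowBelow r (a :: R) (b :: S)

@[simp]
theorem rowBelow_nil_right : RowBelow r R [] := .nil R

@[simp]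
theorem rowBelow_nil_left : RowBelow r [] S ↔ S = [] :=
  ⟨fun h => by cases h; rfl, by rintro rfl; exact .nil []⟩

@[simp]
theorem rowBelow_cons_cons : RowBelow r (a :: R) (b :: S) ↔ r a b ∧ RowBelow r R S :=
  ⟨fun h => by cases h with | cons hab h => exact ⟨hab, h⟩, fun h => .cons h.1 h.2⟩

theorem rowBelow_iff_getElem :
    RowBelow r R S ↔
      ∃ h : S.length ≤ R.length, ∀ i (hi : i < S.length), r (R[i]'(hi.trans_le h)) S[i] := by
  induction S generalizing R with
  | nil => simp
  | cons b S ih =>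
    cases R with
    | nil => simp
    | cons a R =>
      rw [rowBelow_cons_cons, ih]
      constructor
      · rintro ⟨hab, hle, h⟩
        refine ⟨by simpa using hle, fun i hi => ?_⟩
        cases i with
        | zero => exact hab
        | succ i => exact h i (by simpa using hi)
      · rintro ⟨hle, h⟩
        exact ⟨h 0 (by simp), by simpa using hle, fun i hi => h (i + 1) (by simpa using hi)⟩

theorem rowBelow_map {f : α → β} {s : β → β → Prop} :
    RowBelow s (R.map f) (S.map f) ↔ RowBelow (f ⁻¹'o s) R S := by
  simp [rowBelow_iff_getElem, Order.Preimage]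

instance [IsTrans α r] : IsTrans (List α) (RowBelow r) where
  trans R S U hRS hSU := by
    obtain ⟨hle, h⟩ := rowBelow_iff_getElem.1 hRS
    obtain ⟨hle', h'⟩ := rowBelow_iff_getElem.1 hSU
    exact rowBelow_iff_getElem.2
      ⟨hle'.trans hle, fun i hi => _root_.trans (h i (hi.trans_le hle')) (h' i hi)⟩

theorem RowBelow.length_le (h : RowBelow r R S) : S.length ≤ R.length :=
  (rowBelow_iff_getElem.1 h).1

theorem RowBelow.tail (h : RowBelow r R S) : RowBelow r R.tail S.tail := by
  cases h with
  | nil => exact .nil _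
  | cons _ h => exact h

theorem RowBelow.rel_head (h : RowBelow r R S) (ha : R.head? = some a) (hb : S.head? = some b) :
    r a b := by
  cases h <;> simp_all

end RowBelow

section RowLength

variable {α : Type*}

/-- The length of row `i`, with rows counted from `0` and missing rows being empty. -/
def rowLength (T : List (List α)) (i : ℕ) : ℕ :=
  (T.getD i []).length

@[simp]
theorem rowLength_nil (i : ℕ) : rowLength ([] : List (List α)) i = 0 := rfl

@[simp]
theorem rowLength_cons_zero (R : List α) (T : List (List α)) : rowLength (R :: T) 0 = R.length :=
  rfl

@[simp]
theorem rowLength_cons_succ (R : List α) (T : List (List α)) (i : ℕ) :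
    rowLength (R :: T) (i + 1) = rowLength T i := rfl

theorem length_headD_eq_rowLength (T : List (List α)) : (T.headD []).length = rowLength T 0 := by
  cases T <;> rfl

end RowLength

section ReadingWord

variable {α β : Type*} {r : α → α → Prop} {T : List (List α)}

/-- The reading word of a tableau given by the list of its rows: the rows from bottom to top. -/
def readingWord (T : List (List α)) : List α :=
  T.reverse.flatten

@[simp]
theorem readingWord_cons (R : List α) (T : List (List α)) :
    readingWord (R :: T) = readingWord T ++ R := by
  simp [readingWord]

theorem filter_readingWord (p : α → Bool) (T : List (List α)) :
    (readingWord T).filter p = readingWord (T.map (List.filter p)) := by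
  simp [readingWord, List.filter_flatten]

theorem mem_readingWord {a : α} : a ∈ readingWord T ↔ ∃ i, a ∈ T.getD i [] := by
  induction T with
  | nil => simp [readingWord]
  | cons R T ih =>
    rw [readingWord_cons, List.mem_append, ih, or_comm]
    exact Nat.or_exists_add_one (p := fun i => a ∈ (R :: T).getD i [])

theorem exists_readingWord_eq_of_map_eq {f : β → α} {T : List (List α)} {L : List β}
    (h : L.map f = readingWord T) :
    ∃ U : List (List β), readingWord U = L ∧ U.map (List.map f) = T := by
  induction T generalizing L with
  | nil => exact ⟨[], by simpa [readingWord, eq_comm] using h, rfl⟩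
  | cons R T ih =>
    rw [readingWord_cons] at h
    obtain ⟨L₁, L₂, rfl, h₁, rfl⟩ := List.map_eq_append_iff.1 h
    obtain ⟨U, rfl, rfl⟩ := ih h₁
    exact ⟨L₂ :: U, by simp, by simp⟩

/-- The first column of a tableau given by the list of its rows. -/
def firstColumn (T : List (List α)) : List α :=
  T.filterMap List.head?

@[simp]
theorem firstColumn_nil_cons : firstColumn ([] :: T) = firstColumn T := rfl

@[simp]
theorem firstColumn_cons_cons (a : α) (R : List α) :
    firstColumn ((a :: R) :: T) = a :: firstColumn T := rfl

theorem reverse_firstColumn_sublist (T : List (List α)) :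
    (firstColumn T).reverse.Sublist (readingWord T) := by
  induction T with
  | nil => simp [firstColumn]
  | cons R T ih =>
    rw [readingWord_cons]
    cases R with
    | nil => simpa using ih
    | cons a R => simpa using ih.append (show [a].Sublist (a :: R) by simp)

theorem readingWord_map_tail_sublist (T : List (List α)) :
    (readingWord (T.map List.tail)).Sublist (readingWord T) := by
  induction T with
  | nil => simp
  | cons R T ih => simpa using ih.append (List.tail_sublist R)

theorem readingWord_perm_firstColumn_append (T : List (List α)) :
    (readingWord T).Perm (firstColumn T ++ readingWord (T.map List.tail)) := by
  classical
  induction T with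
  | nil => simp [readingWord, firstColumn]
  | cons R T ih =>
    cases R with
    | nil => simpa using ih
    | cons a R =>
      rw [List.perm_iff_count] at ih ⊢
      intro b
      simp only [readingWord_cons, List.map_cons, List.tail_cons, List.count_append, ih b,
        firstColumn_cons_cons, List.count_cons]
      omega

theorem pairwise_firstColumn [IsTrans α r] (h : T.IsChain (RowBelow r)) :
    (firstColumn T).Pairwise r := by
  refine List.pairwise_filterMap.2 (h.pairwise.imp ?_)
  exact fun h _ ha _ hb => h.rel_head ha hb

theorem firstColumn_take [IsTrans α r] (h : T.IsChain (RowBelow r)) (k : ℕ) :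
    firstColumn (T.take k) = (firstColumn T).take k := by
  induction T generalizing k with
  | nil => simp [firstColumn]
  | cons R T ih =>
    cases k with
    | zero => simp [firstColumn]
    | succ k =>
      cases R with
      | nil =>
        have hT : ∀ S ∈ T, S = [] := by simpa using (List.pairwise_cons.1 h.pairwise).1
        have hnil : ∀ U ⊆ T, firstColumn U = [] := fun U hU =>
          List.filterMap_eq_nil_iff.2 fun S hS => by simp [hT S (hU hS)]
        simp [hnil T, hnil _ (List.take_subset k T)]
      | cons a R => simp [ih h.tail]

end ReadingWord

/-! ### Greene's theorem for reading words of tableaux -/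

section Greene

variable {α : Type*} {r : α → α → Prop}

theorem HasChainCover.zero_right (r : α → α → Prop) (w : List α) (k : ℕ) :
    HasChainCover r w k 0 :=
  ⟨w.map (·, k), by simp [Function.comp_def],
    List.pairwise_map.2 (List.pairwise_of_forall fun _ _ _ h => (lt_irrefl k h).elim),
    Nat.zero_le _⟩

theorem HasChainCover.append_chain {w R : List α} {k m : ℕ} (h : HasChainCover r w k m)
    (hR : R.Pairwise r) : HasChainCover r (w ++ R) (k + 1) (m + R.length) := by
  obtain ⟨L, rfl, hL, hm⟩ := h
  refine ⟨L.map (Prod.map id Nat.succ) ++ R.map (·, 0), by simp [Function.comp_def], ?_, ?_⟩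
  · refine List.pairwise_append.2 ⟨?_, List.pairwise_map.2 (hR.imp fun h _ _ => h), by simp; grind⟩
    simpa [IsChainColouring, List.pairwise_map] using hL
  · simpa [List.countP_map, Function.comp_def, List.countP_append] using hm

theorem hasChainCover_readingWord {T : List (List α)} (hrows : ∀ R ∈ T, R.Pairwise r) (k : ℕ) :
    HasChainCover r (readingWord T) k (T.take k).flatten.length := by
  induction T generalizing k with
  | nil => simpa using .zero_right r _ k
  | cons R T ih =>
    cases k with
    | zero => simpa using .zero_right r _ 0
    | succ k =>
      have h := ih (fun S hS => hrows S (List.mem_cons_of_mem R hS)) k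
      simpa [add_comm] using h.append_chain (hrows R List.mem_cons_self)

theorem IsChainColouring.countP_firstColumn_le [IsStrictOrder α r] {T : List (List (α × ℕ))}
    {k : ℕ} (hT : T.IsChain (RowBelow (Prod.fst ⁻¹'o r)))
    (hcol : IsChainColouring r k (readingWord T)) :
    (firstColumn T).countP (·.2 < k) ≤ k := by
  have hdown := pairwise_firstColumn hT
  have hup := List.pairwise_reverse.1 (hcol.sublist (reverse_firstColumn_sublist T))
  -- A column is read upwards, so two of its letters never lie on a common chain.
  have hnodup : (((firstColumn T).filter (·.2 < k)).map Prod.snd).Nodup := by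
    rw [List.Nodup, List.pairwise_map, List.pairwise_filter]
    refine (hdown.and hup).imp fun {p q} ⟨hpq, hqp⟩ _ hq heq => ?_
    exact asymm hpq (hqp heq.symm (by simpa using hq))
  have hsub : ((firstColumn T).filter (·.2 < k)).map Prod.snd ⊆ List.range k := by
    simp [List.subset_def]
  simpa [List.countP_eq_length_filter] using (hnodup.subperm hsub).length_le

theorem IsChainColouring.countP_readingWord_le [IsStrictOrder α r] {T : List (List (α × ℕ))}
    {k : ℕ} (hT : T.IsChain (RowBelow (Prod.fst ⁻¹'o r)))
    (hcol : IsChainColouring r k (readingWord T)) :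
    (readingWord T).countP (·.2 < k) ≤ (T.take k).flatten.length := by
  obtain ⟨N, hN⟩ : ∃ N, ∀ R ∈ T, R.length ≤ N :=
    ⟨(T.map List.length).sum, fun R hR => List.le_sum_of_mem (List.mem_map_of_mem hR)⟩
  induction N generalizing T with
  | zero =>
    have hnil : readingWord T = [] := by simpa [readingWord] using hN
    simp [hnil]
  | succ N ih =>
    have htails : (readingWord (T.map List.tail)).countP (·.2 < k) ≤
        ((T.take k).map List.tail).flatten.length := by
      rw [List.map_take]
      refine ih ?_ (hcol.sublist (readingWord_map_tail_sublist T)) ?_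
      · exact List.isChain_map _ |>.2 (hT.imp fun _ _ h => h.tail)
      · simpa using hN
    have hheads : (firstColumn T).countP (·.2 < k) ≤ (firstColumn (T.take k)).length := by
      rw [firstColumn_take hT, List.length_take]
      exact le_min (hcol.countP_firstColumn_le hT) List.countP_le_length
    have hlength : (T.take k).flatten.length =
        (firstColumn (T.take k)).length + ((T.take k).map List.tail).flatten.length := by
      simpa [readingWord] using (readingWord_perm_firstColumn_append (T.take k)).length_eq
    rw [(readingWord_perm_firstColumn_append T).countP_eq, List.countP_append, hlength]
    exact add_le_add hheads htails

theorem hasChainCover_readingWord_iff [IsStrictOrder α r] {T : List (List α)}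
    (hT : T.IsChain (RowBelow r)) (hrows : ∀ R ∈ T, R.Pairwise r) {k m : ℕ} :
    HasChainCover r (readingWord T) k m ↔ m ≤ (T.take k).flatten.length := by
  constructor
  · rintro ⟨L, hL, hcol, hm⟩
    obtain ⟨U, rfl, rfl⟩ := exists_readingWord_eq_of_map_eq hL
    refine hm.trans ((hcol.countP_readingWord_le ?_).trans_eq ?_)
    · exact (List.isChain_map _).1 hT |>.imp fun _ _ => rowBelow_map.1
    · rw [← List.map_take, ← List.map_flatten, List.length_map]
  · intro hm
    obtain ⟨L, hL, hcol, hcard⟩ := hasChainCover_readingWord hrows k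
    exact ⟨L, hL, hcol, hm.trans hcard⟩

end Greene

/-! ### Row insertion -/

section Tableau

variable {α : Type*} [LinearOrder α] {A B C A' R S : List α} {T U : List (List α)} {a b : α}

/-- The list `T` consists of the rows of a tableau: they are nonempty, and the entries increase
along rows and down columns. -/
structure IsIncreasingTableau (T : List (List α)) : Prop where
  rows : ∀ R ∈ T, R.Pairwise (· < ·)
  columns : T.IsChain (RowBelow (· < ·))
  nil_notMem : [] ∉ T

theorem isIncreasingTableau_nil : IsIncreasingTableau ([] : List (List α)) :=
  ⟨by simp, by simp, by simp⟩

theorem isIncreasingTableau_cons :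
    IsIncreasingTableau (R :: T) ↔ R ≠ [] ∧ R.Pairwise (· < ·) ∧
      RowBelow (· < ·) R (T.headD []) ∧ IsIncreasingTableau T := by
  have hcol : (R :: T).IsChain (RowBelow (· < ·)) ↔
      RowBelow (· < ·) R (T.headD []) ∧ T.IsChain (RowBelow (· < ·)) := by
    cases T <;> simp
  constructor
  · rintro ⟨hrows, hcols, hnil⟩
    rw [List.forall_mem_cons] at hrows
    rw [List.mem_cons, not_or] at hnil
    exact ⟨Ne.symm hnil.1, hrows.1, (hcol.1 hcols).1, hrows.2, (hcol.1 hcols).2, hnil.2⟩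
  · rintro ⟨hR, hrow, hbelow, hT⟩
    exact ⟨List.forall_mem_cons.2 ⟨hrow, hT.rows⟩, hcol.2 ⟨hbelow, hT.columns⟩,
      by simpa [hR.symm] using hT.nil_notMem⟩

theorem IsIncreasingTableau.pairwise_getD (h : IsIncreasingTableau T) (i : ℕ) :
    (T.getD i []).Pairwise (· < ·) := by
  rw [List.getD_eq_getElem?_getD]
  rcases hR : T[i]? with - | R
  · exact .nil
  · exact h.rows R (List.mem_of_getElem? hR)

theorem exists_append_lt_gt (hR : R.Pairwise (· < ·)) (ha : a ∉ R) :
    ∃ A C, R = A ++ C ∧ (∀ x ∈ A, x < a) ∧ ∀ x ∈ C, a < x := by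
  induction R with
  | nil => exact ⟨[], [], by simp⟩
  | cons x R ih =>
    rw [List.pairwise_cons] at hR
    rw [List.mem_cons, not_or] at ha
    rcases lt_or_gt_of_ne ha.1 with hax | hxa
    · exact ⟨[], x :: R, rfl, by simp, by simpa [hax] using fun y hy => hax.trans (hR.1 y hy)⟩
    · obtain ⟨A, C, rfl, hA, hC⟩ := ih hR.2 ha.2
      exact ⟨x :: A, C, rfl, by simpa [hxa] using hA, hC⟩

theorem pairwise_lt_replace (h : (A ++ b :: B).Pairwise (· < ·)) (hA : ∀ x ∈ A, x < a)
    (hB : ∀ x ∈ B, a < x) : (A ++ a :: B).Pairwise (· < ·) := by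
  simp only [List.pairwise_append, List.pairwise_cons, List.forall_mem_cons] at h ⊢
  exact ⟨h.1, ⟨hB, h.2.1.2⟩, fun x hx => ⟨hA x hx, (h.2.2 x hx).2⟩⟩

theorem RowBelow.append_right (h : RowBelow (· < ·) R S) (C : List α) :
    RowBelow (· < ·) (R ++ C) S := by
  rw [rowBelow_iff_getElem] at h ⊢
  grind

theorem RowBelow.of_append_right (h : RowBelow (· < ·) (R ++ C) S) (hlen : S.length ≤ R.length) :
    RowBelow (· < ·) R S := by
  rw [rowBelow_iff_getElem] at h ⊢
  grind

theorem RowBelow.bump (hA : ∀ x ∈ A, x < a) (hab : a < b) (hA' : ∀ x ∈ A', x < b)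
    (h : RowBelow (· < ·) (A ++ b :: B) (A' ++ C)) :
    RowBelow (· < ·) (A ++ a :: B) (A' ++ b :: C.tail) := by
  obtain ⟨hle, h⟩ := rowBelow_iff_getElem.1 h
  have hlen : A'.length ≤ A.length := by
    by_contra! hlt
    have hlt' := h A.length (by grind)
    have hA' := hA' _ (List.getElem_mem hlt)
    grind
  refine rowBelow_iff_getElem.2 ⟨by grind, fun i hi => ?_⟩
  have hi' := h i
  have hAi := fun h : i < A.length => hA _ (List.getElem_mem h)
  grind

theorem RowBelow.length_lt_of_forall_gt (hB : ∀ x ∈ B, b < x)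
    (h : RowBelow (· < ·) (A ++ B) (A' ++ b :: C)) : A'.length < A.length := by
  obtain ⟨hle, h⟩ := rowBelow_iff_getElem.1 h
  by_contra! hlt
  have hlt' := h A'.length (by grind)
  have hB := fun h : A'.length - A.length < B.length => hB _ (List.getElem_mem h)
  grind

theorem RowBelow.unbump (hB : ∀ x ∈ B, b < x) (hC : ∀ x ∈ C, b < x)
    (h : RowBelow (· < ·) (A ++ a :: B) (A' ++ b :: C.tail)) :
    RowBelow (· < ·) (A ++ b :: B) (A' ++ C) := by
  have hlen : A'.length < (A ++ [a]).length := length_lt_of_forall_gt hB (by simpa using h)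
  obtain ⟨hle, h⟩ := rowBelow_iff_getElem.1 h
  refine rowBelow_iff_getElem.2 ⟨by grind, fun i hi => ?_⟩
  have hi' := h i
  have hCi := fun h : i - A'.length < C.length => hC _ (List.getElem_mem h)
  grind

/-- `RowInsertion T a r U`: the row insertion of the letter `a` into the tableau with rows `T` ends
in row `r` (counted from `0`) and produces the tableau with rows `U`. -/
inductive RowInsertion : List (List α) → α → ℕ → List (List α) → Prop
  | nil (a : α) : RowInsertion [] a 0 [[a]]
  | append {R : List α} (T : List (List α)) {a : α} (hR : R ≠ []) (h : ∀ x ∈ R, x < a) :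
      RowInsertion (R :: T) a 0 ((R ++ [a]) :: T)
  | bump {A B : List α} {a b : α} {r : ℕ} {T U : List (List α)} (hA : ∀ x ∈ A, x < a)
      (hab : a < b) (hB : ∀ x ∈ B, b < x) (h : RowInsertion T b r U) :
      RowInsertion ((A ++ b :: B) :: T) a (r + 1) ((A ++ a :: B) :: U)

theorem eq_and_eq_and_eq_of_append_cons_eq_append_cons {A B A' B' : List α} {a a' b : α}
    (h : A ++ a :: B = A' ++ a' :: B') (ha : a < b) (ha' : a' < b) (hB : ∀ x ∈ B, b < x)
    (hB' : ∀ x ∈ B', b < x) : A = A' ∧ a = a' ∧ B = B' := by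
  have hnot : ∀ {x}, x < b → x ∉ B ∧ x ∉ B' := fun hx =>
    ⟨fun h => (hB _ h).asymm hx, fun h => (hB' _ h).asymm hx⟩
  rcases List.append_eq_append_iff.1 h with ⟨D, rfl, hD⟩ | ⟨D, rfl, hD⟩ <;> cases D <;>
    grind

namespace RowInsertion

variable {r r' : ℕ} {T' U' : List (List α)}

theorem headD_eq_append (h : RowInsertion T a r U) :
    ∃ A C, T.headD [] = A ++ C ∧ U.headD [] = A ++ a :: C.tail ∧
      (∀ x ∈ A, x < a) ∧ ∀ x ∈ C, a < x := by
  cases h with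
  | nil => exact ⟨[], [], by simp⟩
  | @append R T a hR h => exact ⟨R, [], by simpa using h⟩
  | @bump A B a b r T U hA hab hB h =>
    exact ⟨A, b :: B, rfl, rfl, hA, List.forall_mem_cons.2 ⟨hab, fun x hx => hab.trans (hB x hx)⟩⟩

theorem isIncreasingTableau (h : RowInsertion T a r U) (hT : IsIncreasingTableau T) :
    IsIncreasingTableau U := by
  induction h with
  | nil a => simp [isIncreasingTableau_cons, isIncreasingTableau_nil]
  | append T _ h =>
    rw [isIncreasingTableau_cons] at hT ⊢
    obtain ⟨-, hrow, hcol, hT⟩ := hT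
    exact ⟨by simp, List.pairwise_append.2 ⟨hrow, by simp, by simpa using h⟩,
      hcol.append_right _, hT⟩
  | @bump A B a b r T U hA hab hB h ih =>
    rw [isIncreasingTableau_cons] at hT ⊢
    obtain ⟨-, hrow, hcol, hT⟩ := hT
    obtain ⟨A', C, hAC, hU, hA', -⟩ := h.headD_eq_append
    refine ⟨by simp, pairwise_lt_replace hrow hA fun x hx => hab.trans (hB x hx), ?_, ih hT⟩
    rw [hU]
    exact (hAC ▸ hcol).bump hA hab hA'

theorem knuthEquiv_append_singleton (hab : a < b) (hB : (b :: B).Pairwise (· < ·)) :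
    KnuthEquiv (b :: B ++ [a]) (b :: a :: B) := by
  induction B generalizing b with
  | nil => exact .refl _
  | cons c B ih =>
    obtain ⟨hb, hB⟩ := List.pairwise_cons.1 hB
    have hbc : b < c := hb c List.mem_cons_self
    have hmove : KnuthEquiv (b :: (c :: B ++ [a])) (b :: c :: a :: B) := by
      simpa using (ih (hab.trans hbc) hB).append [b] []
    exact hmove.trans _ _ _ (.symm _ _ (.rel _ _ (.right [] B hab hbc)))

theorem knuthEquiv_cons_append (hab : a < b) (hA : ∀ x ∈ A, x < a) (hA' : A.Pairwise (· < ·)) :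
    KnuthEquiv (A ++ b :: a :: B) (b :: (A ++ a :: B)) := by
  induction A with
  | nil => exact .refl _
  | cons x A ih =>
    obtain ⟨hx, hA'⟩ := List.pairwise_cons.1 hA'
    obtain ⟨hxa, hA⟩ := List.forall_mem_cons.1 hA
    have hmove : KnuthEquiv (x :: (A ++ b :: a :: B)) (x :: b :: (A ++ a :: B)) := by
      simpa using (ih hA hA').append [x] []
    refine hmove.trans _ _ _ ?_
    cases A with
    | nil => exact .rel _ _ (.left [] B hxa hab)
    | cons y A =>
      exact .rel _ _ (.left [] (A ++ a :: B) (hx y List.mem_cons_self)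
        ((hA y List.mem_cons_self).trans hab))

theorem knuthEquiv (h : RowInsertion T a r U) (hT : ∀ R ∈ T, R.Pairwise (· < ·)) :
    KnuthEquiv (readingWord T ++ [a]) (readingWord U) := by
  induction h with
  | nil a => exact .refl _
  | append T _ _ => simpa using .refl _
  | @bump A B a b _ T U hA hab _ _ ih =>
    obtain ⟨hR, hT⟩ := List.forall_mem_cons.1 hT
    obtain ⟨hA', hbB, -⟩ := List.pairwise_append.1 hR
    have hright := (knuthEquiv_append_singleton hab hbB).append (readingWord T ++ A) []
    have hleft := (knuthEquiv_cons_append (B := B) hab hA hA').append (readingWord T) []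
    have hrest := (ih hT).append [] (A ++ a :: B)
    simp only [readingWord_cons, List.append_assoc, List.cons_append, List.append_nil,
      List.nil_append] at hright hleft hrest ⊢
    exact hright.trans _ _ _ (hleft.trans _ _ _ hrest)

theorem rowLength_eq (h : RowInsertion T a r U) (i : ℕ) :
    rowLength U i = rowLength T i + if i = r then 1 else 0 := by
  induction h generalizing i with
  | nil a => cases i <;> simp
  | append T _ _ => cases i <;> simp
  | bump _ _ _ _ ih => cases i <;> simp [ih]

theorem exists_of_notMem (hT : IsIncreasingTableau T) (hnodup : (readingWord T).Nodup)
    (ha : a ∉ readingWord T) : ∃ r U, RowInsertion T a r U := by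
  induction T generalizing a with
  | nil => exact ⟨0, _, .nil a⟩
  | cons R T ih =>
    obtain ⟨hR, hrow, -, hT'⟩ := isIncreasingTableau_cons.1 hT
    simp only [readingWord_cons, List.nodup_append, List.mem_append, not_or] at hnodup ha
    obtain ⟨A, C, rfl, hA, hC⟩ := exists_append_lt_gt hrow ha.2
    cases C with
    | nil => exact ⟨0, _, .append T hR (by simpa using hA)⟩
    | cons b B =>
      obtain ⟨r, U, h⟩ := ih hT' hnodup.1 fun hb => hnodup.2.2 b hb b (by simp) rfl
      exact ⟨r + 1, _, .bump hA (hC b List.mem_cons_self)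
        (List.pairwise_cons.1 (List.pairwise_append.1 hrow).2.1).1 h⟩

theorem unique (h : RowInsertion T a r U) (h' : RowInsertion T' a' r U) : T = T' ∧ a = a' := by
  obtain ⟨U', hU⟩ : ∃ U', U = U' := ⟨U, rfl⟩
  obtain ⟨r', hr⟩ : ∃ r', r = r' := ⟨r, rfl⟩
  rw [hr, hU] at h'
  induction h generalizing T' a' r' U' with
  | nil a => cases h' <;> simp_all [List.singleton_eq_append_iff]
  | append T hR _ =>
    cases h' with
    | nil => simp_all [List.append_eq_singleton_iff]
    | append T' hR' h' =>
      obtain ⟨hRR, rfl⟩ := List.cons_eq_cons.1 hU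
      simpa using List.append_inj' hRR rfl
    | bump => simp at hr
  | bump _ hab hB _ ih =>
    cases h' with
    | nil => simp at hr
    | append => simp at hr
    | bump hA' hab' hB' h' =>
      obtain ⟨hR, rfl⟩ := List.cons_eq_cons.1 hU
      obtain ⟨rfl, rfl⟩ := ih _ rfl _ h' (Nat.succ_injective hr)
      obtain ⟨rfl, rfl, rfl⟩ :=
        eq_and_eq_and_eq_of_append_cons_eq_append_cons hR hab hab' hB hB'
      exact ⟨rfl, rfl⟩

theorem exists_of_corner_zero (hU : IsIncreasingTableau U) (hr : rowLength U 1 < rowLength U 0) :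
    ∃ T a, RowInsertion T a 0 U ∧ IsIncreasingTableau T := by
  cases U with
  | nil => simp at hr
  | cons R' S =>
    obtain ⟨hne, hrow, hcol, hS⟩ := isIncreasingTableau_cons.1 hU
    obtain ⟨R, a, rfl⟩ : ∃ R a, R' = R ++ [a] :=
      ⟨_, _, (List.dropLast_append_getLast hne).symm⟩
    rw [List.pairwise_append] at hrow
    have hlen : (S.headD []).length ≤ R.length := by
      rw [length_headD_eq_rowLength]
      simpa [Nat.lt_succ_iff] using hr
    by_cases hR : R = []
    · cases S with
      | nil => exact ⟨[], a, by simpa [hR] using .nil a, isIncreasingTableau_nil⟩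
      | cons R'' S => simp_all [isIncreasingTableau_cons]
    · exact ⟨R :: S, a, .append S hR fun x hx => hrow.2.2 x hx a (by simp),
        isIncreasingTableau_cons.2 ⟨hR, hrow.1, hcol.of_append_right hlen, hS⟩⟩

theorem exists_cons_of_isIncreasingTableau_cons {R : List α} (h : RowInsertion T b r U)
    (hT : IsIncreasingTableau T) (hR : IsIncreasingTableau (R :: U)) (hb : b ∉ R) :
    ∃ S a, RowInsertion (S :: T) a (r + 1) (R :: U) ∧ IsIncreasingTableau (S :: T) := by
  obtain ⟨-, hrow, hcol, -⟩ := isIncreasingTableau_cons.1 hR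
  obtain ⟨A', C, hAC, hU, hA', hC⟩ := h.headD_eq_append
  rw [hU] at hcol
  obtain ⟨A, B, rfl, hA, hB⟩ := exists_append_lt_gt hrow hb
  have hlen : 0 < A.length := (Nat.zero_le _).trans_lt (hcol.length_lt_of_forall_gt hB)
  obtain ⟨A, a, rfl⟩ : ∃ A₀ a, A = A₀ ++ [a] :=
    ⟨_, _, (List.dropLast_append_getLast (List.ne_nil_of_length_pos hlen)).symm⟩
  rw [List.append_assoc, List.singleton_append] at hrow hcol ⊢
  have hab : a < b := hA a (by simp)
  refine ⟨A ++ b :: B, a, .bump ?_ hab hB h, isIncreasingTableau_cons.2 ⟨by simp, ?_, ?_, hT⟩⟩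
  · exact fun x hx => (List.pairwise_append.1 hrow).2.2 x hx a List.mem_cons_self
  · exact pairwise_lt_replace hrow (fun x hx => hA x (by simp [hx])) hB
  · exact hAC ▸ hcol.unbump hB hC

theorem exists_of_corner (hU : IsIncreasingTableau U) (hnodup : (readingWord U).Nodup)
    (hr : rowLength U (r + 1) < rowLength U r) :
    ∃ T a, RowInsertion T a r U ∧ IsIncreasingTableau T := by
  induction r generalizing U with
  | zero => exact exists_of_corner_zero hU hr
  | succ r ih =>
    cases U with
    | nil => simp at hr
    | cons R U =>
      rw [readingWord_cons, List.nodup_append] at hnodup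
      have hU' := (isIncreasingTableau_cons.1 hU).2.2.2
      obtain ⟨T, b, h, hT⟩ := ih hU' hnodup.1 (by simpa using hr)
      have hbU : b ∈ readingWord U :=
        (h.knuthEquiv hT.rows).perm.subset (by simp)
      obtain ⟨S, a, h⟩ :=
        h.exists_cons_of_isIncreasingTableau_cons hT hU fun hb => hnodup.2.2 b hbU b hb rfl
      exact ⟨_, a, h⟩

end RowInsertion

/-- `InsertionTableau w s T`: the successive row insertion of the letters of `w`, starting from the
empty tableau, produces the tableau with rows `T`, and `s` lists the rows in which the insertions
end. The word `s` encodes the recording tableau. -/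
inductive InsertionTableau : List α → List ℕ → List (List α) → Prop
  | nil : InsertionTableau [] [] []
  | snoc {w : List α} {s : List ℕ} {T U : List (List α)} {a : α} {r : ℕ}
      (h : InsertionTableau w s T) (hU : RowInsertion T a r U) :
      InsertionTableau (w ++ [a]) (s ++ [r]) U

namespace InsertionTableau

variable {w w' : List α} {s : List ℕ}

theorem isIncreasingTableau (h : InsertionTableau w s T) : IsIncreasingTableau T := by
  induction h with
  | nil => exact isIncreasingTableau_nil
  | snoc _ hU ih => exact hU.isIncreasingTableau ih

theorem knuthEquiv (h : InsertionTableau w s T) : KnuthEquiv w (readingWord T) := by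
  induction h with
  | nil => exact .refl _
  | @snoc w s T U a r h hU ih =>
    have hsnoc : KnuthEquiv (w ++ [a]) (readingWord T ++ [a]) := ih.append [] [a]
    exact hsnoc.trans _ _ _ (hU.knuthEquiv h.isIncreasingTableau.rows)

theorem length_eq (h : InsertionTableau w s T) : w.length = s.length := by
  induction h with
  | nil => rfl
  | snoc _ _ ih => simp [ih]

theorem rowLength_eq (h : InsertionTableau w s T) (i : ℕ) : rowLength T i = s.count i := by
  induction h with
  | nil => simp
  | snoc _ hU ih => grind [hU.rowLength_eq i]

theorem exists_take (h : InsertionTableau w s T) (k : ℕ) :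
    ∃ S, InsertionTableau (w.take k) (s.take k) S := by
  induction h with
  | nil => exact ⟨[], by simpa using .nil⟩
  | @snoc w s T U a r h hU ih =>
    rcases le_or_gt k w.length with hk | hk
    · simpa [List.take_append_of_le_length, hk, h.length_eq ▸ hk] using ih
    · refine ⟨U, ?_⟩
      rw [List.take_of_length_le (by simpa using hk),
        List.take_of_length_le (by simpa [← h.length_eq] using hk)]
      exact h.snoc hU

theorem exists_of_nodup (hw : w.Nodup) : ∃ s T, InsertionTableau w s T := by
  induction w using List.reverseRecOn with
  | nil => exact ⟨_, _, .nil⟩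
  | append_singleton w a ih =>
    rw [List.nodup_append] at hw
    obtain ⟨s, T, hT⟩ := ih hw.1
    have hperm := hT.knuthEquiv.perm
    obtain ⟨r, U, hU⟩ := RowInsertion.exists_of_notMem hT.isIncreasingTableau
      (hperm.nodup_iff.1 hw.1) fun ha => hw.2.2 a (hperm.mem_iff.2 ha) a (by simp) rfl
    exact ⟨_, U, hT.snoc hU⟩

theorem word_unique (h : InsertionTableau w s T) (h' : InsertionTableau w' s T) : w = w' := by
  obtain ⟨s', hs⟩ : ∃ s', s = s' := ⟨s, rfl⟩
  rw [hs] at h'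
  induction h generalizing w' s' with
  | nil =>
    cases h' with
    | nil => rfl
    | snoc => simp at hs
  | snoc _ hU ih =>
    cases h' with
    | nil => simp at hs
    | snoc h' hU' =>
      obtain ⟨hprefix, hlast⟩ := List.append_inj' hs rfl
      obtain rfl := List.singleton_injective hlast
      obtain ⟨rfl, rfl⟩ := hU.unique hU'
      rw [ih _ h' hprefix]

/-- The hypothesis `hs` says that `s` is a Yamanouchi word. -/
theorem exists_word (hT : IsIncreasingTableau T) (hnodup : (readingWord T).Nodup)
    (hs : ∀ k, Antitone fun i => (s.take k).count i) (hlen : ∀ i, rowLength T i = s.count i) :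
    ∃ w, InsertionTableau w s T := by
  induction s using List.reverseRecOn generalizing T with
  | nil =>
    cases T with
    | nil => exact ⟨[], .nil⟩
    | cons R T =>
      have hR : R = [] := by simpa using hlen 0
      exact ((isIncreasingTableau_cons.1 hT).1 hR).elim
  | append_singleton s r ih =>
    have hprefix (k : ℕ) (hk : k ≤ s.length) : (s ++ [r]).take k = s.take k :=
      List.take_append_of_le_length hk
    have hcorner : rowLength T (r + 1) < rowLength T r := by
      have hanti : s.count (r + 1) ≤ s.count r := by
        simpa [hprefix] using hs s.length r.le_succ
      simpa [hlen, List.count_append, List.count_singleton, Nat.lt_succ_iff] using hanti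
    obtain ⟨S, a, h, hS⟩ := RowInsertion.exists_of_corner hT hnodup hcorner
    have hperm := (h.knuthEquiv hS.rows).perm
    obtain ⟨w, hw⟩ := ih hS (List.nodup_append.1 (hperm.nodup_iff.2 hnodup)).1
      (fun k => by simpa [← List.take_take, hprefix] using hs (min k s.length))
      (fun i => by grind [h.rowLength_eq i])
    exact ⟨w ++ [a], hw.snoc h⟩

end InsertionTableau

theorem RowBelow.filter_le (h : RowBelow (· < ·) R S) (hS : S.Pairwise (· < ·)) (k : α) :
    RowBelow (· < ·) (R.filter (· ≤ k)) (S.filter (· ≤ k)) := by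
  induction h with
  | nil => simp
  | @cons a b R S hab _ ih =>
    obtain ⟨hbS, hS⟩ := List.pairwise_cons.1 hS
    by_cases hb : b ≤ k
    · simpa [hb, hab.le.trans hb, hab] using ih hS
    · have hnil : (b :: S).filter (· ≤ k) = [] := by
        simpa [hb] using fun x hx => (not_le.1 hb).trans (hbS x hx)
      simp [hnil]

/-- The part of a tableau formed by the letters `≤ k`. Rows may become empty. -/
def restrictLE (T : List (List α)) (k : α) : List (List α) :=
  T.map (List.filter (· ≤ k))

theorem rowLength_restrictLE (T : List (List α)) (k : α) (i : ℕ) :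
    rowLength (restrictLE T k) i = ((T.getD i []).filter (· ≤ k)).length := by
  exact congrArg List.length (List.getD_map T [] (List.filter (· ≤ k)))

theorem readingWord_restrictLE (T : List (List α)) (k : α) :
    readingWord (restrictLE T k) = (readingWord T).filter (· ≤ k) :=
  (filter_readingWord _ T).symm

theorem IsIncreasingTableau.pairwise_restrictLE (h : IsIncreasingTableau T) (k : α) :
    ∀ R ∈ restrictLE T k, R.Pairwise (· < ·) := by
  simpa [restrictLE] using fun R hR => (h.rows R hR).filter (· ≤ k)

theorem IsIncreasingTableau.isChain_restrictLE (h : IsIncreasingTableau T) (k : α) :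
    (restrictLE T k).IsChain (RowBelow (· < ·)) := by
  induction T with
  | nil => exact .nil
  | cons R T ih =>
    obtain ⟨-, -, hRT, hT⟩ := isIncreasingTableau_cons.1 h
    cases T with
    | nil => exact .singleton _
    | cons S T =>
      exact .cons_cons (hRT.filter_le (hT.pairwise_getD 0) k) (ih hT)

theorem antitone_rowLength {β : Type*} {r : β → β → Prop} {T : List (List β)}
    (h : T.IsChain (RowBelow r)) : Antitone (rowLength T) := by
  refine antitone_nat_of_succ_le fun i => ?_
  induction T generalizing i with
  | nil => simp
  | cons R T ih =>
    cases i with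
    | zero =>
      cases T with
      | nil => simp
      | cons S T => simpa using (List.isChain_cons_cons.1 h).1.length_le
    | succ i => simpa using ih h.tail i

theorem lt_length_filter_le_iff (hR : R.Pairwise (· < ·)) {k : α} {j : ℕ} :
    j < (R.filter (· ≤ k)).length ↔ ∃ h : j < R.length, R[j] ≤ k := by
  induction R generalizing j with
  | nil => simp
  | cons a R ih =>
    obtain ⟨haR, hR⟩ := List.pairwise_cons.1 hR
    by_cases ha : a ≤ k
    · cases j with
      | zero => simp [ha]
      | succ j => simpa [ha] using ih hR
    · have hgt : ∀ x ∈ a :: R, k < x :=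
        List.forall_mem_cons.2 ⟨not_le.1 ha, fun x hx => (not_le.1 ha).trans (haR x hx)⟩
      have hnil : (a :: R).filter (· ≤ k) = [] := by simpa using hgt
      simpa [hnil] using fun h => hgt _ (List.getElem_mem h)

theorem eq_of_length_filter_le_eq (hR : R.Pairwise (· < ·)) (hS : S.Pairwise (· < ·))
    (h : ∀ k, (R.filter (· ≤ k)).length = (S.filter (· ≤ k)).length) : R = S := by
  have hiff (k : α) (j : ℕ) : (∃ h : j < R.length, R[j] ≤ k) ↔ ∃ h : j < S.length, S[j] ≤ k := by
    rw [← lt_length_filter_le_iff hR, ← lt_length_filter_le_iff hS, h]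
  have hlen : R.length = S.length := le_antisymm
    (le_of_forall_lt fun j hj => ((hiff R[j] j).1 ⟨hj, le_rfl⟩).1)
    (le_of_forall_lt fun j hj => ((hiff S[j] j).2 ⟨hj, le_rfl⟩).1)
  exact List.ext_getElem hlen fun j hj hj' => le_antisymm
    ((hiff S[j] j).2 ⟨hj', le_rfl⟩).2 ((hiff R[j] j).1 ⟨hj, le_rfl⟩).2

theorem IsIncreasingTableau.eq_of_rowLength_restrictLE_eq (hT : IsIncreasingTableau T)
    (hU : IsIncreasingTableau U)
    (h : ∀ k i, rowLength (restrictLE T k) i = rowLength (restrictLE U k) i) : T = U := by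
  induction T generalizing U with
  | nil =>
    cases U with
    | nil => rfl
    | cons S U =>
      obtain ⟨hS, hrow, -⟩ := isIncreasingTableau_cons.1 hU
      exact (hS (eq_of_length_filter_le_eq .nil hrow fun k => h k 0).symm).elim
  | cons R T ih =>
    cases U with
    | nil =>
      obtain ⟨hR, hrow, -⟩ := isIncreasingTableau_cons.1 hT
      exact (hR (eq_of_length_filter_le_eq hrow .nil fun k => h k 0)).elim
    | cons S U =>
      obtain ⟨-, hR, -, hT⟩ := isIncreasingTableau_cons.1 hT
      obtain ⟨-, hS, -, hU⟩ := isIncreasingTableau_cons.1 hU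
      rw [eq_of_length_filter_le_eq hR hS fun k => h k 0, ih hT hU fun k i => h k (i + 1)]

end Tableau

/-! ### Standard tableaux and recording words -/

section StandardTableau

variable {T : List (List ℕ)} {n : ℕ}

/-- The list `T` consists of the rows of a standard tableau with entries `1, …, n`. -/
structure IsStandardTableau (n : ℕ) (T : List (List ℕ)) : Prop extends IsIncreasingTableau T where
  perm : (readingWord T).Perm (List.range' 1 n)

theorem IsStandardTableau.nodup (hT : IsStandardTableau n T) : (readingWord T).Nodup :=
  hT.perm.nodup_iff.2 List.nodup_range'

/-- The row in which the entry `a` of a tableau lies. -/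
def rowIndex {α : Type*} [DecidableEq α] (T : List (List α)) (a : α) : ℕ :=
  T.findIdx (a ∈ ·)

theorem rowIndex_eq_iff {α : Type*} [DecidableEq α] {T : List (List α)} {a : α}
    (hT : (readingWord T).Nodup) (ha : a ∈ readingWord T) {i : ℕ} :
    rowIndex T a = i ↔ a ∈ T.getD i [] := by
  induction T generalizing i with
  | nil => simp [readingWord] at ha
  | cons R T ih =>
    rw [readingWord_cons] at hT ha
    obtain ⟨hT, -, hdisj⟩ := List.nodup_append.1 hT
    by_cases hR : a ∈ R
    · cases i with
      | zero => simp [rowIndex, List.findIdx_cons, hR]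
      | succ i =>
        have hi : a ∉ T.getD i [] := fun h => hdisj a (mem_readingWord.2 ⟨i, h⟩) a hR rfl
        simpa [rowIndex, List.findIdx_cons, hR] using hi
    · have ha : a ∈ readingWord T := (List.mem_append.1 ha).resolve_right hR
      cases i with
      | zero => simp [rowIndex, List.findIdx_cons, hR]
      | succ i => simpa [rowIndex, List.findIdx_cons, hR] using ih hT ha

/-- The word listing the rows of the letters `1, …, n` of a tableau. For a standard tableau it is
a Yamanouchi word. -/
def recordingWord (n : ℕ) (T : List (List ℕ)) : List ℕ :=
  (List.range' 1 n).map (rowIndex T)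

theorem length_recordingWord (n : ℕ) (T : List (List ℕ)) : (recordingWord n T).length = n := by
  simp [recordingWord]

theorem count_take_recordingWord (hT : IsStandardTableau n T) (k i : ℕ) :
    ((recordingWord n T).take k).count i = rowLength (restrictLE T k) i := by
  have hinit {a : ℕ} : a ∈ (List.range' 1 n).take k ↔ a ∈ List.range' 1 n ∧ a ≤ k := by
    rcases le_total k n with hk | hk
    · rw [List.take_range'_of_length_ge hk, List.mem_range'_1, List.mem_range'_1]
      lia
    · rw [List.take_range'_of_length_le hk, List.mem_range'_1]
      lia
  have hrow {a : ℕ} : a ∈ List.range' 1 n ∧ rowIndex T a = i ↔ a ∈ T.getD i [] := by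
    rw [← hT.perm.mem_iff]
    exact ⟨fun h => (rowIndex_eq_iff hT.nodup h.1).1 h.2, fun h =>
      have ha := mem_readingWord.2 ⟨i, h⟩
      ⟨ha, (rowIndex_eq_iff hT.nodup ha).2 h⟩⟩
  rw [recordingWord, ← List.map_take, List.count, List.countP_map,
    List.countP_eq_length_filter, rowLength_restrictLE]
  refine List.Perm.length_eq ((List.perm_ext_iff_of_nodup ?_ ?_).2 fun a => ?_)
  · exact ((List.take_sublist _ _).nodup List.nodup_range').filter _
  · exact ((hT.pairwise_getD i).imp fun h => h.ne).filter _
  · simp only [List.mem_filter, hinit, ← hrow, Function.comp_apply, beq_iff_eq, decide_eq_true_eq,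
      and_right_comm]

theorem eq_of_count_take_eq {α : Type*} [DecidableEq α] {s t : List α} (hlen : s.length = t.length)
    (h : ∀ k a, (s.take k).count a = (t.take k).count a) : s = t := by
  refine List.ext_getElem hlen fun i hs ht => ?_
  have := h (i + 1) s[i]
  rw [List.take_succ_eq_append_getElem hs, List.take_succ_eq_append_getElem ht, List.count_append,
    List.count_append, h] at this
  by_contra hne
  simp [Ne.symm hne] at this

end StandardTableau

/-! ### Greene's shape in terms of words -/

section GreeneWord

variable {α β : Type*}

open scoped Classical in
theorem le_maxChainUnion_iff [PartialOrder α] {S : Finset α} {k m : ℕ} :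
    m ≤ maxChainUnion S k ↔ ∃ C : Fin k → Finset α,
      (∀ i, IsChain (· ≤ ·) (C i : Set α)) ∧ (∀ i, C i ⊆ S) ∧
        m ≤ (Finset.univ.biUnion C).card := by
  rcases m.eq_zero_or_pos with rfl | hm
  · simpa using ⟨fun _ => ∅, by simp, by simp⟩
  · rw [maxChainUnion, Finset.le_sup_iff hm]
    simp only [Finset.mem_filter, Finset.mem_powerset]
    constructor
    · rintro ⟨_, ⟨hS, C, hC, rfl⟩, hm⟩
      exact ⟨C, hC, fun i => (Finset.subset_biUnion_of_mem C (Finset.mem_univ i)).trans hS, hm⟩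
    · rintro ⟨C, hC, hS, hm⟩
      exact ⟨_, ⟨Finset.biUnion_subset.2 fun i _ => hS i, C, hC, rfl⟩, hm⟩

theorem le_maxChainUnion_iff_exists_colouring [PartialOrder α] {S : Finset α} {k m : ℕ} :
    m ≤ maxChainUnion S k ↔ ∃ g : α → ℕ,
      (∀ p ∈ S, ∀ q ∈ S, g p = g q → g p < k → p ≤ q ∨ q ≤ p) ∧
        m ≤ (S.filter (g · < k)).card := by
  classical
  rw [le_maxChainUnion_iff]
  constructor
  · rintro ⟨C, hC, hCS, hm⟩
    have hcolour (p : α) : ∃ c : ℕ, (∀ h : c < k, p ∈ C ⟨c, h⟩) ∧ ((∃ i, p ∈ C i) → c < k) := by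
      by_cases h : ∃ i, p ∈ C i
      · obtain ⟨i, hi⟩ := h
        exact ⟨i, fun _ => hi, fun _ => i.2⟩
      · exact ⟨k, fun h => absurd h (lt_irrefl _), fun h' => absurd h' h⟩
    choose g hmem hlt using hcolour
    refine ⟨g, fun p _ q _ hpq hp => (hC ⟨g p, hp⟩).total (hmem p hp) ?_,
      hm.trans (Finset.card_le_card fun p hp => ?_)⟩
    · simpa only [hpq, Finset.mem_coe] using hmem q (hpq ▸ hp)
    · obtain ⟨i, -, hi⟩ := Finset.mem_biUnion.1 hp
      exact Finset.mem_filter.2 ⟨hCS i hi, hlt p ⟨i, hi⟩⟩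
  · rintro ⟨g, hg, hm⟩
    refine ⟨fun i => S.filter (g · = i), fun i p hp q hq _ => ?_,
      fun i => Finset.filter_subset _ _, hm.trans (Finset.card_le_card fun p hp => ?_)⟩
    · simp only [Finset.coe_filter, Set.mem_ofPred_eq] at hp hq
      exact hg p hp.1 q hq.1 (hp.2.trans hq.2.symm) (hp.2.trans_lt i.2)
    · obtain ⟨hpS, hpk⟩ := Finset.mem_filter.1 hp
      exact Finset.mem_biUnion.2 ⟨⟨g p, hpk⟩, Finset.mem_univ _, by simpa using hpS⟩

theorem exists_eq_map_prodMk {γ : Type*} [Inhabited γ] {l : List α} (hl : l.Nodup) {v : α → β}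
    {L : List (β × γ)} (hL : L.map Prod.fst = l.map v) :
    ∃ g : α → γ, L = l.map fun p => (v p, g p) := by
  classical
  induction l generalizing L with
  | nil => exact ⟨fun _ => default, by simpa using hL⟩
  | cons a l ih =>
    obtain ⟨hal, hl⟩ := List.nodup_cons.1 hl
    obtain ⟨⟨x, c⟩, L', rfl, rfl, hL'⟩ := List.map_eq_cons_iff.1 hL
    obtain ⟨g, rfl⟩ := ih hl hL'
    have hg : ∀ b ∈ l, Function.update g a c b = g b := fun b hb =>
      Function.update_of_ne (by rintro rfl; exact hal hb) _ _
    exact ⟨Function.update g a c, by simpa using fun b hb => (hg b hb).symm⟩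

theorem hasChainCover_map_iff {r : β → β → Prop} {l : List α} (hl : l.Nodup) {v : α → β}
    {k m : ℕ} : HasChainCover r (l.map v) k m ↔ ∃ g : α → ℕ,
      (l.Pairwise fun p q => g p = g q → g p < k → r (v p) (v q)) ∧ m ≤ l.countP (g · < k) := by
  constructor
  · rintro ⟨L, hL, hcol, hm⟩
    obtain ⟨g, rfl⟩ := exists_eq_map_prodMk hl hL
    exact ⟨g, List.pairwise_map.1 hcol, by simpa [List.countP_map, Function.comp_def] using hm⟩
  · rintro ⟨g, hg, hm⟩
    exact ⟨l.map fun p => (v p, g p), by simp, List.pairwise_map.2 hg,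
      by simpa [List.countP_map, Function.comp_def] using hm⟩

theorem le_maxChainUnion_iff_hasChainCover [PartialOrder α] {r : β → β → Prop} {S : Finset α}
    {l : List α} (hl : l.Nodup) (hS : ∀ p, p ∈ S ↔ p ∈ l) {v : α → β}
    (hv : l.Pairwise fun p q => ¬ q ≤ p ∧ (p ≤ q ↔ r (v p) (v q))) {k m : ℕ} :
    m ≤ maxChainUnion S k ↔ HasChainCover r (l.map v) k m := by
  classical
  obtain rfl : S = l.toFinset := by ext; simp [hS]
  rw [le_maxChainUnion_iff_exists_colouring, hasChainCover_map_iff hl]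
  refine exists_congr fun g => and_congr ?_ ?_
  · simp only [List.mem_toFinset]
    constructor
    · intro hg
      exact hv.imp_of_mem fun hp hq ⟨hqp, hpq⟩ heq hk =>
        hpq.1 ((hg _ hp _ hq heq hk).resolve_right hqp)
    · intro hg p hp q hq
      refine List.Pairwise.forall_of_forall_of_flip
        (R := fun p q => g p = g q → g p < k → p ≤ q ∨ q ≤ p) (fun p _ _ _ => .inl le_rfl)
        (hv.and hg |>.imp fun ⟨⟨_, hpq⟩, h⟩ heq hk => .inl (hpq.2 (h heq hk)))
        (hv.and hg |>.imp fun ⟨⟨_, hpq⟩, h⟩ heq hk => ?_) hp hq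
      exact .inr (hpq.2 (h heq.symm (heq.symm.trans_lt hk)))
  · rw [List.countP_eq_length_filter, ← List.toFinset_card_of_nodup (hl.filter _),
      List.toFinset_filter]
    simp only [decide_eq_true_eq]

theorem greeneRow_eq_rowLength [PartialOrder α] [Preorder β] {S : Finset α} {l : List α}
    (hl : l.Nodup) (hS : ∀ p, p ∈ S ↔ p ∈ l) {v : α → β}
    (hv : l.Pairwise fun p q => ¬ q ≤ p ∧ (p ≤ q ↔ v p < v q)) {T : List (List β)}
    (hT : T.IsChain (RowBelow (· < ·))) (hrows : ∀ R ∈ T, R.Pairwise (· < ·))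
    (hlT : KnuthEquiv (l.map v) (readingWord T)) (i : ℕ) :
    greeneRow S i = rowLength T i := by
  have hcard (k : ℕ) : maxChainUnion S k = (T.take k).flatten.length := by
    refine eq_of_forall_le_iff fun m => ?_
    rw [le_maxChainUnion_iff_hasChainCover hl hS hv, hlT.hasChainCover_iff,
      hasChainCover_readingWord_iff hT hrows]
  rw [greeneRow, hcard, hcard, rowLength, List.take_add_one, List.flatten_append,
    List.length_append, List.getD_eq_getElem?_getD]
  cases T[i]? <;> simp

end GreeneWord

/-! ### Words of permutations -/

section PermutationWord

variable {n : ℕ}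

/-- The points of the permutation poset, ordered by position. -/
def permPoints (σ : Equiv.Perm (Fin n)) : List (PermutationPoset σ) :=
  (List.finRange n).map fun i => ⟨(i, σ i), rfl⟩

/-- The word of values of a permutation of `[n]`, with letters `1, …, n`. -/
def permWord (σ : Equiv.Perm (Fin n)) : List ℕ :=
  (permPoints σ).map fun p => (p.1.2 : ℕ) + 1

theorem permWord_eq_ofFn (σ : Equiv.Perm (Fin n)) :
    permWord σ = List.ofFn fun i => (σ i : ℕ) + 1 := by
  simp [permWord, permPoints, List.ofFn_eq_map, Function.comp_def]

theorem permWord_injective : Function.Injective (permWord (n := n)) := by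
  intro σ τ h
  rw [permWord_eq_ofFn, permWord_eq_ofFn] at h
  ext i
  simpa using congrFun (List.ofFn_injective h) i

theorem permWord_perm (σ : Equiv.Perm (Fin n)) : (permWord σ).Perm (List.range' 1 n) := by
  have hid : permWord (Equiv.refl (Fin n)) = List.range' 1 n := by
    rw [permWord_eq_ofFn]
    exact List.ext_getElem (by simp) (by simp [add_comm])
  rw [← hid, permWord_eq_ofFn, permWord_eq_ofFn]
  exact Equiv.Perm.ofFn_comp_perm σ fun i => (i : ℕ) + 1

theorem exists_permWord_eq {w : List ℕ} (hw : w.Perm (List.range' 1 n)) :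
    ∃ σ : Equiv.Perm (Fin n), permWord σ = w := by
  obtain rfl : w.length = n := by simpa using hw.length_eq
  have hmem (i : Fin w.length) : 1 ≤ w[i] ∧ w[i] < 1 + w.length :=
    List.mem_range'_1.1 (hw.subset (List.getElem_mem i.2))
  let f (i : Fin w.length) : Fin w.length := ⟨w[i] - 1, by have := hmem i; lia⟩
  have hf : Function.Injective f := by
    intro i j hij
    have : w[i] - 1 = w[j] - 1 := congrArg Fin.val hij
    have hget : w[i] = w[j] := by have := hmem i; have := hmem j; lia
    exact Fin.ext ((hw.nodup_iff.2 List.nodup_range').getElem_inj_iff.1 hget)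
  refine ⟨Equiv.ofBijective f (Finite.injective_iff_bijective.1 hf), ?_⟩
  rw [permWord_eq_ofFn]
  exact List.ext_getElem (by simp) fun i _ hi => by
    simpa [f] using Nat.sub_add_cancel (hmem ⟨i, hi⟩).1

theorem nodup_permPoints (σ : Equiv.Perm (Fin n)) : (permPoints σ).Nodup :=
  (List.nodup_finRange n).map fun _ _ h => congrArg (fun p => p.1.1) h

theorem mem_take_permPoints {σ : Equiv.Perm (Fin n)} {k : ℕ} {p : PermutationPoset σ} :
    p ∈ (permPoints σ).take k ↔ (p.1.1 : ℕ) < k := by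
  have htake (i : Fin n) : i ∈ (List.finRange n).take k ↔ (i : ℕ) < k := by
    simp [List.mem_take_iff_getElem, Fin.ext_iff]
  rw [permPoints, ← List.map_take, List.mem_map]
  constructor
  · rintro ⟨i, hi, rfl⟩
    exact (htake i).1 hi
  · exact fun hp => ⟨p.1.1, (htake _).2 hp, Subtype.ext (Prod.ext rfl p.2.symm)⟩

theorem mem_permPoints {σ : Equiv.Perm (Fin n)} (p : PermutationPoset σ) : p ∈ permPoints σ :=
  List.mem_of_mem_take (mem_take_permPoints.2 p.1.1.2)

theorem pairwise_permPoints (σ : Equiv.Perm (Fin n)) : (permPoints σ).Pairwise fun p q =>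
    ¬ q ≤ p ∧ (p ≤ q ↔ (p.1.2 : ℕ) + 1 < q.1.2 + 1) := by
  rw [permPoints, List.pairwise_map]
  refine (List.pairwise_lt_finRange n).imp fun {i j} hij => ?_
  have hne : σ i ≠ σ j := σ.injective.ne hij.ne
  simp only [Subtype.mk_le_mk, Prod.mk_le_mk, add_lt_add_iff_right, Fin.val_fin_lt]
  exact ⟨fun h => h.1.not_gt hij, fun h => h.2.lt_of_ne hne, fun h => ⟨hij.le, h.le⟩⟩

theorem PosetLinearExtension.mem_firstElements {α : Type*} [PartialOrder α] [Fintype α]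
    {φ : PosetLinearExtension α n} {k : ℕ} {p : α} :
    p ∈ φ.firstElements k ↔ (φ.toFun p : ℕ) < k := by
  simp [PosetLinearExtension.firstElements]

theorem greeneRow_linearExtensionByPosition {σ : Equiv.Perm (Fin n)} {s : List ℕ}
    {T : List (List ℕ)} (h : InsertionTableau (permWord σ) s T) (k i : ℕ) :
    greeneRow ((linearExtensionByPosition σ).firstElements k) i = (s.take k).count i := by
  obtain ⟨S, hS⟩ := h.exists_take k
  rw [← hS.rowLength_eq]
  refine greeneRow_eq_rowLength (l := (permPoints σ).take k)
    (v := fun p : PermutationPoset σ => (p.1.2 : ℕ) + 1) ?_ (fun p => ?_) ?_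
    hS.isIncreasingTableau.columns hS.isIncreasingTableau.rows ?_ i
  · exact (List.take_sublist _ _).nodup (nodup_permPoints σ)
  · rw [mem_take_permPoints, PosetLinearExtension.mem_firstElements]
    rfl
  · exact (pairwise_permPoints σ).sublist (List.take_sublist _ _)
  · simpa only [permWord, List.map_take] using hS.knuthEquiv

theorem greeneRow_linearExtensionByValue {σ : Equiv.Perm (Fin n)} {s : List ℕ}
    {T : List (List ℕ)} (h : InsertionTableau (permWord σ) s T) (k i : ℕ) :
    greeneRow ((linearExtensionByValue σ).firstElements k) i = rowLength (restrictLE T k) i := by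
  have hT := h.isIncreasingTableau
  refine greeneRow_eq_rowLength (l := (permPoints σ).filter fun p => (p.1.2 : ℕ) + 1 ≤ k)
    (v := fun p : PermutationPoset σ => (p.1.2 : ℕ) + 1) ?_ (fun p => ?_) ?_
    (hT.isChain_restrictLE k) (hT.pairwise_restrictLE k) ?_ i
  · exact (nodup_permPoints σ).filter _
  · simp [mem_permPoints, PosetLinearExtension.mem_firstElements, linearExtensionByValue]
  · exact (pairwise_permPoints σ).filter _
  · have hfilter := h.knuthEquiv.filter_le k
    rwa [permWord, List.filter_map, ← readingWord_restrictLE] at hfilter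

end PermutationWord

/-! ### Standard Young tableaux as lists of rows -/

namespace StandardYoungTableau

variable {μ : YoungDiagram} (P : StandardYoungTableau μ)

/-- The list of the rows of a standard Young tableau, without empty rows. -/
def rows : List (List ℕ) :=
  (List.range (μ.colLen 0)).map fun i => (List.range (μ.rowLen i)).map (P.entry i)

theorem entry_mem_Icc {i j : ℕ} (h : (i, j) ∈ μ) : P.entry i j ∈ Set.Icc 1 μ.card :=
  P.bijOn'.mapsTo h

theorem eq_of_entry_eq {i j i' j' : ℕ} (h : (i, j) ∈ μ) (h' : (i', j') ∈ μ)
    (heq : P.entry i j = P.entry i' j') : i = i' ∧ j = j' :=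
  Prod.mk.inj (P.bijOn'.injOn h h' heq)

theorem getD_rows (i : ℕ) : P.rows.getD i [] = (List.range (μ.rowLen i)).map (P.entry i) := by
  rw [List.getD_eq_getElem?_getD, rows, List.getElem?_map]
  rcases lt_or_ge i (μ.colLen 0) with hi | hi
  · simp [hi]
  · have hrow : μ.rowLen i = 0 := by
      by_contra hpos
      exact hi.not_gt (μ.mem_iff_lt_colLen.1 (μ.mem_iff_lt_rowLen.2 (Nat.pos_of_ne_zero hpos)))
    simp [hi, hrow]

theorem pairwise_getD_rows (i : ℕ) : (P.rows.getD i []).Pairwise (· < ·) := by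
  rw [getD_rows, List.pairwise_map]
  refine List.pairwise_lt_range.imp_of_mem fun {j j'} hj hj' hjj' => ?_
  rw [List.mem_range, ← μ.mem_iff_lt_rowLen] at hj hj'
  exact (P.row_weak' hjj' hj').lt_of_ne fun h => hjj'.ne (P.eq_of_entry_eq hj hj' h).2

theorem mem_getD_rows {i a : ℕ} :
    a ∈ P.rows.getD i [] ↔ ∃ j, (i, j) ∈ μ ∧ P.entry i j = a := by
  rw [getD_rows]
  simp [μ.mem_iff_lt_rowLen]

theorem isIncreasingTableau_rows : IsIncreasingTableau P.rows where
  rows R hR := by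
    obtain ⟨i, hi, rfl⟩ := List.getElem_of_mem hR
    simpa only [List.getD_eq_getElem _ _ hi] using P.pairwise_getD_rows i
  columns := by
    refine (List.isChain_map _).2 ((List.isChain_range _ _).2 fun i _ => ?_)
    refine rowBelow_iff_getElem.2 ⟨by simpa using μ.rowLen_anti _ _ i.le_succ, fun j hj => ?_⟩
    have hmem : (i + 1, j) ∈ μ := μ.mem_iff_lt_rowLen.2 (by simpa using hj)
    simpa using P.col_strict' i.lt_succ_self hmem
  nil_notMem hnil := by
    obtain ⟨i, hi, hrow⟩ := List.mem_map.1 hnil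
    have hcorner := μ.mem_iff_lt_rowLen.1 (μ.mem_iff_lt_colLen.2 (List.mem_range.1 hi))
    simp_all

theorem nodup_readingWord_rows : (readingWord P.rows).Nodup := by
  rw [readingWord, List.nodup_flatten, List.pairwise_reverse, rows, List.pairwise_map]
  refine ⟨fun R hR => ?_, List.pairwise_lt_range.imp fun {i i'} hii' a ha' ha => ?_⟩
  · exact (P.isIncreasingTableau_rows.rows R (List.mem_reverse.1 hR)).imp fun h => h.ne
  · rw [← getD_rows, mem_getD_rows] at ha ha'
    obtain ⟨j, hj, rfl⟩ := ha
    obtain ⟨j', hj', heq⟩ := ha'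
    exact hii'.ne' (P.eq_of_entry_eq hj' hj heq).1

theorem isStandardTableau_rows {n : ℕ} (hμ : μ.card = n) : IsStandardTableau n P.rows where
  toIsIncreasingTableau := P.isIncreasingTableau_rows
  perm := by
    subst hμ
    refine (List.perm_ext_iff_of_nodup P.nodup_readingWord_rows List.nodup_range').2 fun a => ?_
    simp only [mem_readingWord, mem_getD_rows, List.mem_range'_1]
    constructor
    · rintro ⟨i, j, hij, rfl⟩
      have := P.entry_mem_Icc hij
      grind
    · intro ha
      obtain ⟨⟨i, j⟩, hij, hentry⟩ := P.bijOn'.surjOn (show a ∈ Set.Icc 1 μ.card by grind)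
      exact ⟨i, j, hij, hentry⟩

theorem lt_rowLength_restrictLE_rows_iff {k i j : ℕ} :
    j < rowLength (restrictLE P.rows k) i ↔ (i, j) ∈ μ ∧ P.entry i j ≤ k := by
  rw [rowLength_restrictLE, lt_length_filter_le_iff (P.pairwise_getD_rows i)]
  simp only [getD_rows]
  simp [μ.mem_iff_lt_rowLen]

end StandardYoungTableau

section RowsEq

variable {n : ℕ} {T : List (List ℕ)}

theorem IsIncreasingTableau.rowBelow_getD (hT : IsIncreasingTableau T) {i i' : ℕ} (h : i < i') :
    RowBelow (· < ·) (T.getD i []) (T.getD i' []) := by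
  rcases lt_or_ge i' T.length with hi' | hi'
  · rw [List.getD_eq_getElem _ _ hi', List.getD_eq_getElem _ _ (h.trans hi')]
    exact List.pairwise_iff_getElem.1 hT.columns.pairwise _ _ _ _ h
  · rw [List.getD_eq_default _ _ hi']
    exact .nil _

theorem exists_youngDiagram_mem_iff (hT : Antitone (rowLength T)) :
    ∃ μ : YoungDiagram, ∀ i j, (i, j) ∈ μ ↔ j < rowLength T i := by
  have hsorted : (T.map List.length).SortedGE := by
    refine List.sortedGE_iff_getElem_ge_getElem_of_le.2 fun i i' hi hi' h => ?_
    rw [List.length_map] at hi hi'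
    simpa [rowLength, hi, hi'] using hT h
  refine ⟨.ofRowLens _ hsorted, fun i j => YoungDiagram.mem_ofRowLens.trans ?_⟩
  rcases lt_or_ge i T.length with hi | hi <;> simp [rowLength, hi]

/-- The entry in row `i` and column `j` of the tableau with the given rows, with the junk value `0`
outside the tableau. -/
def rowEntry (T : List (List ℕ)) (i j : ℕ) : ℕ :=
  (T.getD i []).getD j 0

theorem rowEntry_eq_getElem {i j : ℕ} (h : j < rowLength T i) :
    rowEntry T i j = (T.getD i [])[j]'h :=
  List.getD_eq_getElem _ _ h

theorem IsStandardTableau.bijOn_rowEntry (hT : IsStandardTableau n T) :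
    Set.BijOn (fun c : ℕ × ℕ => rowEntry T c.1 c.2) {c | c.2 < rowLength T c.1} (Set.Icc 1 n) := by
  have hletter {a : ℕ} : a ∈ Set.Icc 1 n ↔ a ∈ readingWord T := by
    rw [hT.perm.mem_iff, List.mem_range'_1, Set.mem_Icc]
    lia
  have hmem {i j : ℕ} (h : j < rowLength T i) : rowEntry T i j ∈ T.getD i [] :=
    rowEntry_eq_getElem h ▸ List.getElem_mem h
  refine ⟨fun c hc => hletter.2 (mem_readingWord.2 ⟨c.1, hmem hc⟩), ?_, fun a ha => ?_⟩
  · rintro ⟨i, j⟩ (hij : j < rowLength T i) ⟨i', j'⟩ (hij' : j' < rowLength T i')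
      (heq : rowEntry T i j = rowEntry T i' j')
    have hindex {i j : ℕ} (h : j < rowLength T i) : rowIndex T (rowEntry T i j) = i :=
      (rowIndex_eq_iff hT.nodup (mem_readingWord.2 ⟨i, hmem h⟩)).2 (hmem h)
    obtain rfl : i = i' := by rw [← hindex hij, heq, hindex hij']
    rw [rowEntry_eq_getElem hij, rowEntry_eq_getElem hij'] at heq
    have hnodup : (T.getD i []).Nodup := (hT.pairwise_getD i).imp fun h => h.ne
    obtain rfl : j = j' := hnodup.getElem_inj_iff.1 heq
    rfl
  · obtain ⟨i, hi⟩ := mem_readingWord.1 (hletter.1 ha)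
    obtain ⟨j, hj, rfl⟩ := List.getElem_of_mem hi
    exact ⟨(i, j), hj, rowEntry_eq_getElem hj⟩

theorem IsStandardTableau.exists_rows_eq (hT : IsStandardTableau n T) :
    ∃ (μ : YoungDiagram) (P : StandardYoungTableau μ), μ.card = n ∧ P.rows = T := by
  obtain ⟨μ, hμ⟩ := exists_youngDiagram_mem_iff (antitone_rowLength hT.columns)
  have hbij : Set.BijOn (fun c : ℕ × ℕ => rowEntry T c.1 c.2) {c | c ∈ μ} (Set.Icc 1 n) := by
    simpa only [hμ] using hT.bijOn_rowEntry
  have hcard : μ.card = n := by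
    rw [YoungDiagram.card, ← Set.ncard_coe_finset]
    exact hbij.ncard_eq.trans (by simp)
  let P : StandardYoungTableau μ :=
    { entry := rowEntry T
      row_weak' := by
        intro i j j' hjj' hj'
        rw [hμ] at hj'
        rw [rowEntry_eq_getElem hj', rowEntry_eq_getElem (hjj'.trans hj')]
        exact (List.pairwise_iff_getElem.1 (hT.pairwise_getD i) _ _ _ _ hjj').le
      col_strict' := by
        intro i i' j hii' hj
        rw [hμ] at hj
        obtain ⟨hle, hlt⟩ := rowBelow_iff_getElem.1 (hT.rowBelow_getD hii')
        rw [rowEntry_eq_getElem hj, rowEntry_eq_getElem (hj.trans_le hle)]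
        exact hlt j hj
      zeros' := by
        intro i j hij
        rw [hμ, not_lt] at hij
        exact List.getD_eq_default _ _ hij
      bijOn' := hcard ▸ hbij }
  refine ⟨μ, P, hcard, P.isIncreasingTableau_rows.eq_of_rowLength_restrictLE_eq
    hT.toIsIncreasingTableau fun k i => eq_of_forall_lt_iff fun j => ?_⟩
  rw [P.lt_rowLength_restrictLE_rows_iff, rowLength_restrictLE,
    lt_length_filter_le_iff (hT.pairwise_getD i), hμ, ← exists_prop]
  exact exists_congr fun hj => by rw [← rowEntry_eq_getElem hj]

end RowsEq

/-! ### The Robinson–Schensted correspondence -/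

section LinearExtension

variable {α β : Type*} [PartialOrder α] [PartialOrder β]

theorem maxChainUnion_map (e : α ↪o β) (S : Finset α) (k : ℕ) :
    maxChainUnion (S.map e.toEmbedding) k = maxChainUnion S k := by
  refine eq_of_forall_le_iff fun m => ?_
  rw [le_maxChainUnion_iff_exists_colouring, le_maxChainUnion_iff_exists_colouring,
    e.injective.surjective_comp_right.exists]
  simp [Finset.filter_map]

theorem greeneRow_map (e : α ↪o β) (S : Finset α) (i : ℕ) :
    greeneRow (S.map e.toEmbedding) i = greeneRow S i := by
  rw [greeneRow, greeneRow, maxChainUnion_map, maxChainUnion_map]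

variable [Fintype α] {n : ℕ} {φ ψ : PosetLinearExtension α n} {μ ν : YoungDiagram}

theorem isTableauOfLinearExtension_iff {P : StandardYoungTableau μ} :
    IsTableauOfLinearExtension φ P ↔
      ∀ k i, greeneRow (φ.firstElements k) i = rowLength (restrictLE P.rows k) i := by
  simp only [IsTableauOfLinearExtension, Set.ext_iff, greeneShape, Prod.forall, Set.mem_ofPred_eq,
    ← P.lt_rowLength_restrictLE_rows_iff]
  exact forall₂_congr fun k i =>
    ⟨fun h => eq_of_forall_lt_iff fun j => (h j).symm, fun h j => by rw [h]⟩

namespace IsTableauOfLinearExtension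

theorem coe_shape {P : StandardYoungTableau μ} (hP : IsTableauOfLinearExtension φ P) :
    (μ : Set (ℕ × ℕ)) = greeneShape (Finset.univ : Finset α) := by
  have huniv : φ.firstElements (n + μ.card) = Finset.univ := by
    ext p
    simpa [PosetLinearExtension.mem_firstElements] using (φ.toFun p).2.trans_le (n.le_add_right _)
  rw [← huniv, ← hP]
  exact Set.ext fun c => (and_iff_left_of_imp fun hc =>
    (P.entry_mem_Icc hc).2.trans (Nat.le_add_left _ n)).symm

theorem shape_unique {P : StandardYoungTableau μ} {Q : StandardYoungTableau ν}
    (hP : IsTableauOfLinearExtension φ P) (hQ : IsTableauOfLinearExtension ψ Q) : μ = ν :=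
  SetLike.coe_injective (hP.coe_shape.trans hQ.coe_shape.symm)

theorem unique {P Q : StandardYoungTableau μ} (hP : IsTableauOfLinearExtension φ P)
    (hQ : IsTableauOfLinearExtension φ Q) : P = Q := by
  have hentry : P.toSemistandardYoungTableau = Q.toSemistandardYoungTableau := by
    refine SemistandardYoungTableau.ext fun i j => ?_
    by_cases hij : (i, j) ∈ μ
    · refine eq_of_forall_ge_iff fun k => ?_
      simpa [hij] using Set.ext_iff.1 ((hP k).trans (hQ k).symm) (i, j)
    · exact (P.zeros' hij).trans (Q.zeros' hij).symm
  cases P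
  cases Q
  congr

end IsTableauOfLinearExtension

end LinearExtension

section RobinsonSchensted

variable {n : ℕ} {σ : Equiv.Perm (Fin n)} {μ : YoungDiagram} {s : List ℕ} {T U : List (List ℕ)}

theorem InsertionTableau.isTableauOfLinearExtension_byValue_iff
    (h : InsertionTableau (permWord σ) s T) {P : StandardYoungTableau μ} :
    IsTableauOfLinearExtension (linearExtensionByValue σ) P ↔ P.rows = T := by
  simp only [isTableauOfLinearExtension_iff, greeneRow_linearExtensionByValue h]
  constructor
  · intro hP
    exact P.isIncreasingTableau_rows.eq_of_rowLength_restrictLE_eq h.isIncreasingTableau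
      fun k i => (hP k i).symm
  · rintro rfl k i
    rfl

theorem InsertionTableau.isTableauOfLinearExtension_byPosition_iff
    (h : InsertionTableau (permWord σ) s T) {Q : StandardYoungTableau μ} (hμ : μ.card = n) :
    IsTableauOfLinearExtension (linearExtensionByPosition σ) Q ↔ recordingWord n Q.rows = s := by
  have hQ : IsStandardTableau n Q.rows := Q.isStandardTableau_rows hμ
  have hlen : (recordingWord n Q.rows).length = s.length := by
    rw [length_recordingWord, ← h.length_eq, permWord_eq_ofFn, List.length_ofFn]
  simp only [isTableauOfLinearExtension_iff, greeneRow_linearExtensionByPosition h,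
    ← count_take_recordingWord hQ]
  constructor
  · exact fun hs => eq_of_count_take_eq hlen fun k i => (hs k i).symm
  · rintro rfl k i
    rfl

theorem exists_insertionTableau_permWord (σ : Equiv.Perm (Fin n)) :
    ∃ s T, InsertionTableau (permWord σ) s T :=
  InsertionTableau.exists_of_nodup ((permWord_perm σ).nodup_iff.2 List.nodup_range')

theorem InsertionTableau.isStandardTableau (h : InsertionTableau (permWord σ) s T) :
    IsStandardTableau n T :=
  ⟨h.isIncreasingTableau, h.knuthEquiv.perm.symm.trans (permWord_perm σ)⟩

theorem isRobinsonSchenstedPair_iff {T : StandardYoungTableauPair n} :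
    IsRobinsonSchenstedPair σ T ↔
      InsertionTableau (permWord σ) (recordingWord n T.Q.rows) T.P.rows := by
  constructor
  · rintro ⟨hP, hQ⟩
    obtain ⟨s, U, h⟩ := exists_insertionTableau_permWord σ
    rwa [h.isTableauOfLinearExtension_byValue_iff.1 hP,
      (h.isTableauOfLinearExtension_byPosition_iff T.card_shape).1 hQ]
  · intro h
    exact ⟨h.isTableauOfLinearExtension_byValue_iff.2 rfl,
      (h.isTableauOfLinearExtension_byPosition_iff T.card_shape).2 rfl⟩

/-- The reflection of the permutation poset in the diagonal, which exchanges positions and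
values. -/
def PermutationPoset.swap (σ : Equiv.Perm (Fin n)) :
    PermutationPoset σ ↪o PermutationPoset σ⁻¹ where
  toFun p := ⟨p.1.swap, by simp [p.2]⟩
  inj' p q h := Subtype.ext (Prod.swap_injective (congrArg Subtype.val h))
  map_rel_iff' := Prod.swap_le_swap

theorem firstElements_linearExtensionByValue_inv (σ : Equiv.Perm (Fin n)) (k : ℕ) :
    (linearExtensionByValue σ⁻¹).firstElements k =
      ((linearExtensionByPosition σ).firstElements k).map
        (PermutationPoset.swap σ).toEmbedding := by
  ext p
  obtain ⟨q, rfl⟩ : ∃ q, PermutationPoset.swap σ q = p := ⟨⟨p.1.swap, by simp [p.2]⟩, rfl⟩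
  refine Iff.trans ?_ (Finset.mem_map' (PermutationPoset.swap σ).toEmbedding).symm
  rw [PosetLinearExtension.mem_firstElements, PosetLinearExtension.mem_firstElements]
  rfl

theorem isTableauOfLinearExtension_byPosition_iff_byValue_inv {Q : StandardYoungTableau μ} :
    IsTableauOfLinearExtension (linearExtensionByPosition σ) Q ↔
      IsTableauOfLinearExtension (linearExtensionByValue σ⁻¹) Q := by
  simp only [isTableauOfLinearExtension_iff, firstElements_linearExtensionByValue_inv,
    greeneRow_map]

theorem exists_isTableauOfLinearExtension_byValue (σ : Equiv.Perm (Fin n)) :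
    ∃ (μ : YoungDiagram) (P : StandardYoungTableau μ),
      μ.card = n ∧ IsTableauOfLinearExtension (linearExtensionByValue σ) P := by
  obtain ⟨s, T, h⟩ := exists_insertionTableau_permWord σ
  obtain ⟨μ, P, hμ, hP⟩ := h.isStandardTableau.exists_rows_eq
  exact ⟨μ, P, hμ, h.isTableauOfLinearExtension_byValue_iff.2 hP⟩

theorem exists_isRobinsonSchenstedPair (σ : Equiv.Perm (Fin n)) :
    ∃ T, IsRobinsonSchenstedPair σ T := by
  obtain ⟨μ, P, hμ, hP⟩ := exists_isTableauOfLinearExtension_byValue σ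
  obtain ⟨ν, Q, -, hQ⟩ := exists_isTableauOfLinearExtension_byValue σ⁻¹
  rw [← isTableauOfLinearExtension_byPosition_iff_byValue_inv] at hQ
  obtain rfl := hP.shape_unique hQ
  exact ⟨⟨μ, hμ, P, Q⟩, hP, hQ⟩

theorem IsRobinsonSchenstedPair.unique {T U : StandardYoungTableauPair n}
    (hT : IsRobinsonSchenstedPair σ T) (hU : IsRobinsonSchenstedPair σ U) : T = U := by
  obtain ⟨μ, _, P, Q⟩ := T
  obtain ⟨ν, _, P', Q'⟩ := U
  obtain rfl := hT.1.shape_unique hU.1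
  obtain rfl : P = P' := hT.1.unique hU.1
  obtain rfl : Q = Q' := hT.2.unique hU.2
  rfl

theorem IsRobinsonSchenstedPair.perm_unique {τ : Equiv.Perm (Fin n)}
    {T : StandardYoungTableauPair n} (hσ : IsRobinsonSchenstedPair σ T)
    (hτ : IsRobinsonSchenstedPair τ T) : σ = τ :=
  permWord_injective <|
    (isRobinsonSchenstedPair_iff.1 hσ).word_unique (isRobinsonSchenstedPair_iff.1 hτ)

theorem IsStandardTableau.restrictLE_eq_self (hT : IsStandardTableau n T) :
    restrictLE T n = T := by
  refine (List.map_congr_left fun R hR => List.filter_eq_self.2 fun a ha => ?_).trans T.map_id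
  have hmem : a ∈ readingWord T := by
    rw [readingWord, List.mem_flatten]
    exact ⟨R, List.mem_reverse.2 hR, ha⟩
  rw [hT.perm.mem_iff, List.mem_range'_1] at hmem
  grind

theorem exists_insertionTableau_recordingWord (hT : IsStandardTableau n T)
    (hU : IsStandardTableau n U) (hTU : ∀ i, rowLength T i = rowLength U i) :
    ∃ σ : Equiv.Perm (Fin n), InsertionTableau (permWord σ) (recordingWord n U) T := by
  have hyamanouchi (k : ℕ) : Antitone fun i => ((recordingWord n U).take k).count i := by
    simpa only [count_take_recordingWord hU] using antitone_rowLength (hU.isChain_restrictLE k)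
  have hlen (i : ℕ) : rowLength T i = (recordingWord n U).count i := by
    rw [hTU, ← hU.restrictLE_eq_self, ← count_take_recordingWord hU, hU.restrictLE_eq_self,
      List.take_of_length_le (length_recordingWord n U).le]
  obtain ⟨w, hw⟩ := InsertionTableau.exists_word hT.toIsIncreasingTableau hT.nodup hyamanouchi hlen
  obtain ⟨σ, rfl⟩ := exists_permWord_eq (hw.knuthEquiv.perm.trans hT.perm)
  exact ⟨σ, hw⟩

theorem exists_perm_isRobinsonSchenstedPair (T : StandardYoungTableauPair n) :
    ∃ σ, IsRobinsonSchenstedPair σ T := by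
  have hP : IsStandardTableau n T.P.rows := T.P.isStandardTableau_rows T.card_shape
  have hQ : IsStandardTableau n T.Q.rows := T.Q.isStandardTableau_rows T.card_shape
  obtain ⟨σ, h⟩ := exists_insertionTableau_recordingWord hP hQ fun i => by
    rw [rowLength, rowLength, T.P.getD_rows, T.Q.getD_rows, List.length_map, List.length_map]
  exact ⟨σ, isRobinsonSchenstedPair_iff.2 h⟩

end RobinsonSchensted

/-- The conditions defining `P(σ)` and `Q(σ)` determine a map `RS : σ ↦ (P(σ), Q(σ))` into the pairs
of standard Young tableaux of the same shape with `n` boxes, and this map is a bijection. -/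
theorem corollary3p4 (n : ℕ) :
    ∃ RS : Equiv.Perm (Fin n) → StandardYoungTableauPair n,
      (∀ (σ : Equiv.Perm (Fin n)) (T : StandardYoungTableauPair n),
        RS σ = T ↔ IsRobinsonSchenstedPair σ T) ∧
      Function.Bijective RS := by
  choose RS hRS using exists_isRobinsonSchenstedPair (n := n)
  have hiff (σ : Equiv.Perm (Fin n)) (T : StandardYoungTableauPair n) :
      RS σ = T ↔ IsRobinsonSchenstedPair σ T :=
    ⟨fun h => h ▸ hRS σ, fun h => (hRS σ).unique h⟩
  refine ⟨RS, hiff, fun σ τ h => (hRS σ).perm_unique (h ▸ hRS τ), fun T => ?_⟩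
  obtain ⟨σ, hσ⟩ := exists_perm_isRobinsonSchenstedPair T
  exact ⟨σ, (hiff σ T).2 hσ⟩
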